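/- **Setting.** For each number of qubits $n$, let $U(\theta)=R_d\,E\,R_{d-1}\,E\cdots E\,R_0$ be the EfficientSU2 circuit on $n$ qubits with $d=d(n)$ repetitions. Each rotation layer $R_l$ applies to every qubit a gate $R_Y$ followed by a gate $R_Z$, with independent angles, and the pairwise entangling layer $E$ applies CNOT gates (control first) to the pairs of qubits $(0,1),(2,3),\dots$ and then to the pairs $(1,2),(3,4),\dots$. The depth is logarithmic: $d(n)\in O(\log n)$. All $2n(d+1)$ angles $\theta_k$ are independent and uniform on $[-\pi,\pi]$. Let $D_\phi:\{0,1\}^n\to\mathbb R$ be a fully-connected neural network with any number $L=L(n)\ge 0$ of hidden layers, of widths $m_1,\dots,m_L$ (with $m_0=n$ inputs and $m_{L+1}=1$ output), all depending arbitrarily on $n$. Namely $D^0(x)=x$, $D^l(x)=R_{\gamma_l}\big(A^lD^{l-1}(x)+B^l\big)$ for $1\le l\le L$, where $R_\gamma(t)=\max(t,\gamma t)$ acts entrywise and $0\le\gamma_l\le1$, and $D_\phi(x)=F\big(A^{L+1}D^L(x)+B^{L+1}\big)$, with $F(t)=\log\frac1{1+e^{-t}}$ (min-max GAN) or $F(t)=t$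 (Wasserstein GAN). All entries of the parameter $\phi=(A^l,B^l)_{1\le l\le L+1}$ are independent, and independent of $\theta$; for each $l$, the entries of $A^l$ are identically distributed with a symmetric law of finite standard deviation $\sigma_l$, and the entries of $B^l$ are identically distributed with a symmetric law. Put $$c_\alpha(\phi)=\frac1{2^n}\sum_{x\in\{0,1\}^n}(-1)^{\alpha\cdot x}D_\phi(x),\qquad \mathcal L_\alpha(\theta)=\langle 0|^{\otimes n}\,U(\theta)^\dagger Z_\alpha U(\theta)\,|0\rangle^{\otimes n},\qquad \mathcal L_G(\theta,\phi)=\sum_{\alpha\in\{0,1\}^n}c_\alpha(\phi)\,\mathcal L_\alpha(\theta),$$ where $Z_\alpha$ is the Pauli string with a $Z$ on each qubit $i$ such that $\alpha_i=1$. **Corollary 2.** Suppose that $m_l\sigma_l^2\ge4$ for every hidden layer $1\le l\le L$ and every $n$, and that $\sigma_{L+1}^2\ge s$ for all $n$, with a constant $s>0$ (if the condition $m_l\sigma_l^2\ge4$ is imposed on the output layer too, this holds with $s=4$). Then the generator loss does not suffer from barren plateaus: there are $C>0$ and $p\in\mathbb N$ such that, for all sufficiently large $n$, $$\operatorname{Var}_{\theta,\phi}[\mathcal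 L_G]\ \ge\ \frac{C}{n^p},\qquad\text{that is, } \operatorname{Var}_{\theta,\phi}[\mathcal L_G]\in\Omega\!\left(\frac1{\mathrm{poly}(n)}\right),$$ and there is no $b>1$ such that $\max_k\operatorname{Var}_{\theta,\phi}\big[\partial_{\theta_k}\mathcal L_G\big]\in O(b^{-n})$. Here the variance is $+\infty$ for a variable that is not square integrable; $\mathcal L_G$ is square integrable whenever the biases have finite second moments. -/

import Mathlib

open MeasureTheory ProbabilityTheory Filter Asymptotics
open scoped Matrix ENNReal

namespace QGAN

noncomputable section

/-! ### Qubits, gates and the EfficientSU2 circuit -/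

/-- Bit strings of length `n`; they label the computational basis of `n` qubits. -/
abbrev Bits (n : ℕ) : Type := Fin n → Fin 2

/-- Operators on `n` qubits, as matrices in the computational basis. -/
abbrev Op (n : ℕ) : Type := Matrix (Bits n) (Bits n) ℂ

/-- The tensor product `A₀ ⊗ ⋯ ⊗ Aₙ₋₁` of one single-qubit operator per qubit. -/
def tensorOp {n : ℕ} (A : Fin n → Matrix (Fin 2) (Fin 2) ℂ) : Op n :=
  Matrix.of fun x y => ∏ i, A i (x i) (y i)

/-- The Pauli matrix `Z`. -/
def pauliZ : Matrix (Fin 2) (Fin 2) ℂ := !![1, 0; 0, -1]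

/-- The Pauli string `Z_α`, with a `Z` on every qubit `i` such that `α i = 1`. -/
def pauliZString {n : ℕ} (α : Bits n) : Op n :=
  tensorOp fun i => if α i = 1 then pauliZ else 1

/-- `R_Y(t) = exp(-i t Y / 2)`. -/
def rotY (t : ℝ) : Matrix (Fin 2) (Fin 2) ℂ :=
  !![(Real.cos (t / 2) : ℂ), -(Real.sin (t / 2) : ℂ);
     (Real.sin (t / 2) : ℂ), (Real.cos (t / 2) : ℂ)]

/-- `R_Z(t) = exp(-i t Z / 2)`. -/
def rotZ (t : ℝ) : Matrix (Fin 2) (Fin 2) ℂ :=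
  !![Complex.exp (-(Complex.I * t / 2)), 0; 0, Complex.exp (Complex.I * t / 2)]

/-- The CNOT gate with control qubit `c` and target qubit `t`: it sends the basis vector `|y⟩` to
`|y'⟩`, where `y'` agrees with `y` except that `y' t = y t + y c` modulo 2. -/
def cnot {n : ℕ} (c t : Fin n) : Op n :=
  Matrix.of fun x y => if x = Function.update y t (y t + y c) then 1 else 0

/-- The product of the CNOT gates with control `i` and target `i + 1`, over all `i` of parity `p`
with `i + 1 < n`. These gates act on disjoint pairs of qubits. -/
def cnotLayer (n p : ℕ) : Op n :=
  ((List.finRange (n - 1)).map fun i =>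
    if i.val % 2 = p then
      cnot (⟨i.val, by omega⟩ : Fin n) ⟨i.val + 1, by omega⟩
    else 1).prod

/-- Pairwise entanglement: CNOT gates on the pairs `(0,1), (2,3), …`, followed by CNOT gates on the
pairs `(1,2), (3,4), …`. -/
def pairwiseEntangler (n : ℕ) : Op n := cnotLayer n 1 * cnotLayer n 0

/-- Labels of the parameters of the EfficientSU2 circuit with `d` repetitions: the rotation layer
(from `0` to `d`), the qubit, and the kind of rotation (`0` for `R_Y`, `1` for `R_Z`). -/
abbrev GenParam (n d : ℕ) : Type := Fin (d + 1) × Fin n × Fin 2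

/-- The `l`-th rotation layer: an `R_Y` on each qubit followed by an `R_Z` on each qubit. -/
def rotationLayer {n d : ℕ} (θ : GenParam n d → ℝ) (l : Fin (d + 1)) : Op n :=
  tensorOp (fun j => rotZ (θ (l, j, 1))) * tensorOp (fun j => rotY (θ (l, j, 0)))

/-- The EfficientSU2 circuit `U(θ) = R_d E R_{d-1} E ⋯ E R_0` on `n` qubits, with `d` repetitions,
pairwise entanglement `E` and rotation layers `R_l` of type `(R_Y, R_Z)`. -/
def efficientSU2 {n d : ℕ} (θ : GenParam n d → ℝ) : Op n :=
  Fin.induction (motive := fun _ => Op n) (rotationLayer θ 0)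
    (fun l U => rotationLayer θ l.succ * pairwiseEntangler n * U) (Fin.last d)

/-- The zero state `|0⟩⟨0|` on `n` qubits. -/
def zeroState (n : ℕ) : Op n := Matrix.single 0 0 1

/-- `L_α(θ) = Tr(U(θ) ρ U(θ)† Z_α) = ⟨0| U(θ)† Z_α U(θ) |0⟩`, which is a real number. -/
def pauliLoss {n d : ℕ} (α : Bits n) (θ : GenParam n d → ℝ) : ℝ :=
  (Matrix.trace (efficientSU2 θ * zeroState n * (efficientSU2 θ)ᴴ * pauliZString α)).re

/-- The uniform distribution on `[-π, π]`. -/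
def uniformAngle : Measure ℝ := cond volume (Set.Icc (-Real.pi) Real.pi)

/-- Independent generator parameters, each uniform on `[-π, π]`. -/
def generatorLaw (n d : ℕ) : Measure (GenParam n d → ℝ) := Measure.pi fun _ => uniformAngle

/-! ### Discriminators -/

/-- The leaky ReLU function with parameter `γ`. -/
def leakyReLU (γ x : ℝ) : ℝ := max x (γ * x)

/-- The two kinds of GAN, which differ in the output activation. -/
inductive GANKind : Type
  | minMax
  | wasserstein

/-- The output activation `F`. -/
def GANKind.activation : GANKind → ℝ → ℝ
  | .minMax, x => Real.log (Real.sigmoid x)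
  | .wasserstein, x => x

/-- A fully-connected discriminator with `n` binary inputs and `L` hidden layers, with its
initialization scheme. The affine maps are numbered `1, …, L + 1`; the entry `l : Fin (L + 1)` of
`weightLaw` and of `biasLaw` belongs to the affine map number `l + 1`, and the entry `l : Fin L` of
`hiddenWidth` and of `slope` belongs to the hidden layer number `l + 1`. -/
structure Discriminator (n : ℕ) where
  /-- the number of hidden layers -/
  L : ℕ
  /-- the numbers of neurons of the hidden layers -/
  hiddenWidth : Fin L → ℕ
  /-- the leaky-ReLU parameters -/
  slope : Fin L → ℝ
  slope_nonneg : ∀ l, 0 ≤ slope l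
  slope_le_one : ∀ l, slope l ≤ 1
  /-- the kind of GAN, which fixes the output activation -/
  kind : GANKind
  /-- the common law of the weights of a layer -/
  weightLaw : Fin (L + 1) → Measure ℝ
  /-- the common law of the biases of a layer -/
  biasLaw : Fin (L + 1) → Measure ℝ
  weight_prob : ∀ l, IsProbabilityMeasure (weightLaw l)
  bias_prob : ∀ l, IsProbabilityMeasure (biasLaw l)
  weight_symm : ∀ l, (weightLaw l).map (fun t => -t) = weightLaw l
  bias_symm : ∀ l, (biasLaw l).map (fun t => -t) = biasLaw l
  /-- the weights have a finite standard deviation -/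
  weight_sq : ∀ l, MemLp (fun t : ℝ => t) 2 (weightLaw l)

namespace Discriminator

attribute [instance] Discriminator.weight_prob Discriminator.bias_prob

variable {n : ℕ} (D : Discriminator n)

/-- The widths `m_0 = n, m_1, …, m_L` of the input layer and of the hidden layers. -/
abbrev width : Fin (D.L + 1) → ℕ := Fin.cases n D.hiddenWidth

/-- The standard deviation `σ` of the weights of a layer. -/
def weightStd (l : Fin (D.L + 1)) : ℝ := √(Var[fun t : ℝ => t; D.weightLaw l])

/-- Weight matrix and bias vector of a hidden layer. -/
abbrev HiddenParam (l : Fin D.L) : Type :=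
  (Fin (D.width l.succ) → Fin (D.width l.castSucc) → ℝ) × (Fin (D.width l.succ) → ℝ)

/-- Weight row and bias of the output layer, which has one neuron. -/
abbrev OutputParam : Type := (Fin (D.width (Fin.last D.L)) → ℝ) × ℝ

/-- All parameters `φ` of the discriminator. -/
abbrev Param : Type := (∀ l : Fin D.L, D.HiddenParam l) × D.OutputParam

/-- The law of `φ`: all weights and biases are independent, the weights of each layer follow the
weight law of the layer, and the biases follow its bias law. -/
def paramLaw : Measure D.Param :=
  (Measure.pi fun l : Fin D.L =>
      (Measure.pi fun _ => Measure.pi fun _ => D.weightLaw l.castSucc).prod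
        (Measure.pi fun _ => D.biasLaw l.castSucc)).prod
    ((Measure.pi fun _ => D.weightLaw (Fin.last D.L)).prod (D.biasLaw (Fin.last D.L)))

/-- The values of the neurons of layer `l` on the input `x`: layer `0` is the input, and each hidden
layer applies its affine map, then its leaky ReLU. -/
def neurons (φ : D.Param) (x : Bits n) (l : Fin (D.L + 1)) : Fin (D.width l) → ℝ :=
  Fin.induction (motive := fun l => Fin (D.width l) → ℝ)
    (fun i : Fin n => ((x i).val : ℝ))
    (fun l v i => leakyReLU (D.slope l) (∑ j, (φ.1 l).1 i j * v j + (φ.1 l).2 i)) l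

/-- The output of the discriminator on `x`, with its output activation applied. -/
def output (φ : D.Param) (x : Bits n) : ℝ :=
  D.kind.activation (∑ j, φ.2.1 j * D.neurons φ x (Fin.last D.L) j + φ.2.2)

/-- `c_α(φ) = 2⁻ⁿ ∑ₓ (-1)^(α · x) D_φ(x)`. -/
def coeff (α : Bits n) (φ : D.Param) : ℝ :=
  (1 / 2 ^ n) * ∑ x : Bits n, (-1) ^ (∑ i, (α i).val * (x i).val) * D.output φ x

end Discriminator

/-! ### The generator loss and barren plateaus -/

/-- The generator loss `L_G(θ, φ) = ∑_α c_α(φ) L_α(θ)`. -/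
def generatorLoss {n : ℕ} (d : ℕ) (D : Discriminator n) (θ : GenParam n d → ℝ) (φ : D.Param) : ℝ :=
  ∑ α : Bits n, D.coeff α φ * pauliLoss α θ

/-- The joint law of the independent parameters `θ` and `φ`. -/
def jointLaw {n : ℕ} (d : ℕ) (D : Discriminator n) : Measure ((GenParam n d → ℝ) × D.Param) :=
  (generatorLaw n d).prod D.paramLaw

/-- A family of losses `ℒ n (θ, φ)`, with `(θ, φ)` drawn from `μ n`, exhibits a barren plateau in `θ`
if the variances of its partial derivatives with respect to all the `θ_k` are `O(1 / bⁿ)` for some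
`b > 1`. -/
def HasBarrenPlateau {ι Ω : ℕ → Type} [∀ n, DecidableEq (ι n)] [∀ n, MeasurableSpace (Ω n)]
    (μ : ∀ n, Measure ((ι n → ℝ) × Ω n)) (ℒ : ∀ n, (ι n → ℝ) → Ω n → ℝ) : Prop :=
  ∃ b : ℝ, 1 < b ∧ ∃ C : ℝ, ∀ᶠ n : ℕ in atTop, ∀ k : ι n,
    eVar[fun p => deriv (fun t => ℒ n (Function.update p.1 k t) p.2) (p.1 k); μ n]
      ≤ ENNReal.ofReal (C / b ^ n)

end

end QGAN

/-! The variance is bounded below by testing the loss against one function of the angles. Let `g` be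
bounded by 1 with mean zero, orthogonal to every `pauliLoss α` except the one with a single `Z` on
qubit 0, whose pairing with `g` is `κ`. For fixed `φ`, Cauchy–Schwarz gives that the centred loss
has second moment in `θ` at least `κ² c(φ)²`, where `c` is the coefficient of that Pauli string;
integrating over `φ` gives `le_evariance_of_test`.

Circuit side: qubit 0 is never the target of a CNOT, so in the Heisenberg picture its `Z` passes
through every entangler (`pairwiseEntangler_conj_pauliZString`) and every `R_Z`, while each `R_Y`
turns it into `cos · Z - sin · X`. With `g` the product of the cosines of all `d + 1` angles `R_Y`
of qubit 0, the `X` terms average out and each layer contributes the mean 1/2 of a squared cosine,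
so `κ = 2^-(d+1)` (`integral_pauliLoss_mul_cosTest`). Then `κ²` is polynomially small at logarithmic
depth.

Discriminator side: leaky ReLU and both output activations have a linear odd part. Flipping the
signs of all parameters of a neuron preserves their law, so the odd part alone bounds the second
moment of any linear functional that kills constants (`le_lintegral_neuron`). The width condition
exactly compensates the loss in each hidden layer, so the power present in the input reaches the
output (`le_lintegral_coeff_sq`).

For gradients, the parameter shift rule and an integration by parts replace the last cosine by minus
a sine, with the same `κ` (`integral_pauliLossDeriv_mul_sinTest`). A polynomial lower bound on one
partial derivative excludes a barren plateau. -/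

namespace QGAN

/-! ### Resampling one coordinate of a product measure. -/

section Resampling

variable {ι : Type*} [Fintype ι] [DecidableEq ι] {α : ι → Type*} [∀ i, MeasurableSpace (α i)]
  (μ : ∀ i, Measure (α i)) [∀ i, IsProbabilityMeasure (μ i)]

/-- Resampling one coordinate independently preserves a product of probability measures. -/
theorem measurePreserving_update_pi (i : ι) :
    MeasurePreserving (fun p : (∀ j, α j) × α i => Function.update p.1 i p.2)
      ((Measure.pi μ).prod (μ i)) (Measure.pi μ) := by
  refine ⟨measurable_update', ?_⟩
  refine (Measure.pi_eq fun s hs => ?_).symm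
  rw [Measure.map_apply measurable_update' (MeasurableSet.univ_pi hs)]
  have : (fun p : (∀ j, α j) × α i => Function.update p.1 i p.2) ⁻¹' Set.univ.pi s
      = (Set.univ.pi (Function.update s i Set.univ)) ×ˢ s i := by
    ext ⟨x, y⟩
    simp only [Set.mem_preimage, Set.mem_pi, Set.mem_univ, true_implies, Set.mem_prod]
    constructor
    · intro h
      refine ⟨fun j => ?_, by simpa using h i⟩
      by_cases hj : j = i
      · subst hj; simp
      · simpa [hj] using h j
    · rintro ⟨h, hy⟩ j
      by_cases hj : j = i
      · subst hj; simpa using hy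
      · simpa [hj] using h j
  rw [this, Measure.prod_prod, Measure.pi_pi,
    ← Finset.mul_prod_erase _ (fun j => μ j (s j)) (Finset.mem_univ i),
    ← Finset.mul_prod_erase _ _ (Finset.mem_univ i), Function.update_self, measure_univ, one_mul,
    mul_comm]
  congr 1
  refine Finset.prod_congr rfl fun j hj => ?_
  rw [Function.update_of_ne (Finset.ne_of_mem_erase hj)]

/-- Applied to the layers of the discriminator: a fresh copy of the parameters of one layer can be
averaged while the earlier neurons stay fixed. -/
theorem lintegral_pi_update (i : ι) {f : (∀ j, α j) → ℝ≥0∞} (hf : Measurable f) :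
    ∫⁻ x, f x ∂Measure.pi μ
      = ∫⁻ x, ∫⁻ y, f (Function.update x i y) ∂μ i ∂Measure.pi μ := by
  rw [← (measurePreserving_update_pi μ i).lintegral_comp hf, lintegral_prod]
  exact (hf.comp measurable_update').aemeasurable

theorem integral_pi_update (i : ι) {f : (∀ j, α j) → ℝ} (hf : Integrable f (Measure.pi μ)) :
    ∫ x, f x ∂Measure.pi μ
      = ∫ x, ∫ y, f (Function.update x i y) ∂μ i ∂Measure.pi μ := by
  have h := measurePreserving_update_pi μ i
  have hi : Integrable (fun p : (∀ j, α j) × α i => f (Function.update p.1 i p.2))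
      ((Measure.pi μ).prod (μ i)) := h.integrable_comp_of_integrable hf
  rw [← integral_prod _ hi]
  conv_lhs => rw [← h.map_eq]
  exact integral_map h.measurable.aemeasurable (by rw [h.map_eq]; exact hf.aestronglyMeasurable)

end Resampling

/-! ### Lower bound for the variance by a test function. -/

section Variance

variable {Θ Φ A : Type*} [MeasurableSpace Θ] [MeasurableSpace Φ] [Fintype A] [DecidableEq A]
  (μ : Measure Θ) (ν : Measure Φ) [IsProbabilityMeasure μ] [IsProbabilityMeasure ν]

/-- Cauchy–Schwarz with no integrability assumption on `f`: if the product is not integrable, the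
Bochner integral is 0 by convention and the bound still holds. -/
theorem sq_enorm_integral_mul_le {f g : Θ → ℝ} (hf : AEStronglyMeasurable f μ)
    (hg : ∀ t, |g t| ≤ 1) :
    ‖∫ t, f t * g t ∂μ‖ₑ ^ 2 ≤ ∫⁻ t, ‖f t‖ₑ ^ 2 ∂μ := by
  have h1 : ‖∫ t, f t * g t ∂μ‖ₑ ≤ eLpNorm f 1 μ := by
    refine (enorm_integral_le_lintegral_enorm _).trans ?_
    rw [eLpNorm_one_eq_lintegral_enorm]
    refine lintegral_mono fun t => ?_
    rw [enorm_mul]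
    refine mul_le_of_le_one_right' ?_
    rw [← ofReal_norm]
    exact ENNReal.ofReal_le_one.2 (hg t)
  have h2 : eLpNorm f 1 μ ≤ eLpNorm f 2 μ :=
    eLpNorm_le_eLpNorm_of_exponent_le (by norm_num) hf
  have h3 : eLpNorm f 2 μ ^ 2 = ∫⁻ t, ‖f t‖ₑ ^ 2 ∂μ := by
    rw [← ENNReal.rpow_natCast, eLpNorm_eq_lintegral_rpow_enorm_toReal (by norm_num) (by norm_num),
      ← ENNReal.rpow_mul]
    simp
  rw [← h3]
  gcongr
  exact h1.trans h2

/-- A loss that is linear in the coefficients `c a`, and whose component `a` is detected by a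
bounded test function `g` only for `a = b`, has at least the variance contributed by `c b`. -/
theorem le_evariance_of_test {c : A → Φ → ℝ} {ℓ : A → Θ → ℝ} {g : Θ → ℝ} {κ : ℝ} (b : A)
    (hc : ∀ a, Measurable (c a)) (hℓm : ∀ a, Measurable (ℓ a))
    (hℓ : ∀ a, Integrable (fun t => ℓ a t * g t) μ) (hgi : Integrable g μ)
    (hg : ∀ t, |g t| ≤ 1) (hg0 : ∫ t, g t ∂μ = 0)
    (hort : ∀ a, ∫ t, ℓ a t * g t ∂μ = if a = b then κ else 0) :
    ENNReal.ofReal (κ ^ 2) * ∫⁻ φ, ‖c b φ‖ₑ ^ 2 ∂ν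
      ≤ eVar[fun ω : Θ × Φ => ∑ a, c a ω.2 * ℓ a ω.1; μ.prod ν] := by
  unfold evariance
  -- If the loss is not integrable, `m` is the default value 0. Its value never matters, because `g`
  -- has mean zero and kills every constant.
  set m := ∫ ω : Θ × Φ, ∑ a, c a ω.2 * ℓ a ω.1 ∂μ.prod ν
  have hmeas : Measurable fun ω : Θ × Φ => ‖∑ a, c a ω.2 * ℓ a ω.1 - m‖ₑ ^ 2 := by
    have : Measurable fun ω : Θ × Φ => ∑ a, c a ω.2 * ℓ a ω.1 :=
      Finset.measurable_sum _ fun a _ =>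
        ((hc a).comp measurable_snd).mul ((hℓm a).comp measurable_fst)
    exact (this.sub_const m).enorm.pow_const 2
  rw [lintegral_prod_symm _ hmeas.aemeasurable, ← lintegral_const_mul _ ((hc b).enorm.pow_const 2)]
  refine lintegral_mono fun φ => ?_
  have hm : Measurable fun t => ∑ a, c a φ * ℓ a t - m :=
    (Finset.measurable_sum _ fun a _ => (hℓm a).const_mul _).sub_const m
  refine le_trans (le_of_eq ?_) (sq_enorm_integral_mul_le μ hm.aestronglyMeasurable hg)
  have hi : ∫ t, (∑ a, c a φ * ℓ a t - m) * g t ∂μ = c b φ * κ := by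
    have h1 : ∀ t, (∑ a, c a φ * ℓ a t - m) * g t
        = ∑ a, c a φ * (ℓ a t * g t) - m * g t := fun t => by
      rw [sub_mul, Finset.sum_mul]
      simp only [mul_assoc]
    simp_rw [h1]
    rw [integral_sub (integrable_finsetSum _ fun a _ => (hℓ a).const_mul _) (hgi.const_mul m),
      integral_finsetSum _ fun a _ => (hℓ a).const_mul _]
    simp_rw [integral_const_mul, hg0, hort]
    simp
  rw [hi, enorm_mul, mul_pow, mul_comm, ← enorm_pow κ, Real.enorm_of_nonneg (sq_nonneg κ)]

end Variance

/-! ### Averages over uniform angles. -/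

section Angles

theorem uniformAngle_eq :
    uniformAngle = (ENNReal.ofReal (2 * Real.pi))⁻¹ •
      volume.restrict (Set.Icc (-Real.pi) Real.pi) := by
  rw [uniformAngle, ProbabilityTheory.cond, Real.volume_Icc]
  congr 3
  ring

instance : IsProbabilityMeasure uniformAngle :=
  cond_isProbabilityMeasure_of_finite (by simp [Real.volume_Icc, Real.pi_pos])
    (by simp [Real.volume_Icc])

theorem integral_uniformAngle (f : ℝ → ℝ) :
    ∫ t, f t ∂uniformAngle = (2 * Real.pi)⁻¹ * ∫ t in (-Real.pi)..Real.pi, f t := by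
  rw [uniformAngle_eq, integral_smul_measure, integral_Icc_eq_integral_Ioc,
    intervalIntegral.integral_of_le (by linarith [Real.pi_pos]), ENNReal.toReal_inv,
    ENNReal.toReal_ofReal (by positivity), smul_eq_mul]

theorem ae_mem_uniformAngle : ∀ᵐ t ∂uniformAngle, t ∈ Set.Icc (-Real.pi) Real.pi := by
  exact ae_cond_mem measurableSet_Icc

/-- Orthogonality of 1, cosine and sine over a period, with mean square 1/2 for the last two. -/
theorem integral_trig_uniformAngle (a p q u v : ℝ) :
    ∫ t, (a + p * Real.cos t + q * Real.sin t) * (u * Real.cos t + v * Real.sin t) ∂uniformAngle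
      = (p * u + q * v) / 2 := by
  rw [integral_uniformAngle]
  have h : ∀ t, (a + p * Real.cos t + q * Real.sin t) * (u * Real.cos t + v * Real.sin t)
      = a * u * Real.cos t + a * v * Real.sin t + p * u * Real.cos t ^ 2
        + q * v * Real.sin t ^ 2 + (p * v + q * u) * (Real.sin t * Real.cos t) := fun t => by ring
  simp_rw [h]
  have hi : ∀ f : ℝ → ℝ, Continuous f → IntervalIntegrable f volume (-Real.pi) Real.pi :=
    fun f hf => hf.intervalIntegrable _ _
  rw [intervalIntegral.integral_add (hi _ (by fun_prop)) (hi _ (by fun_prop)),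
    intervalIntegral.integral_add (hi _ (by fun_prop)) (hi _ (by fun_prop)),
    intervalIntegral.integral_add (hi _ (by fun_prop)) (hi _ (by fun_prop)),
    intervalIntegral.integral_add (hi _ (by fun_prop)) (hi _ (by fun_prop))]
  simp only [intervalIntegral.integral_const_mul, integral_cos, integral_sin, integral_cos_sq,
    integral_sin_sq, integral_sin_mul_cos₁]
  simp
  field_simp

theorem integral_trig_uniformAngle' (p q : ℝ) :
    ∫ t, (p * Real.cos t + q * Real.sin t) ∂uniformAngle = 0 := by
  rw [integral_uniformAngle]
  have hi : ∀ f : ℝ → ℝ, Continuous f → IntervalIntegrable f volume (-Real.pi) Real.pi :=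
    fun f hf => hf.intervalIntegrable _ _
  rw [intervalIntegral.integral_add (hi _ (by fun_prop)) (hi _ (by fun_prop))]
  simp

instance (n d : ℕ) : IsProbabilityMeasure (generatorLaw n d) := by
  unfold generatorLaw; infer_instance

theorem exists_bound_generatorLaw {n d : ℕ} {f : (GenParam n d → ℝ) → ℝ} (hf : Continuous f) :
    ∃ C, ∀ᵐ θ ∂generatorLaw n d, ‖f θ‖ ≤ C := by
  obtain ⟨C, hC⟩ := (isCompact_univ_pi fun _ : GenParam n d =>
    isCompact_Icc (a := -Real.pi) (b := Real.pi)).exists_bound_of_continuousOn hf.continuousOn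
  refine ⟨C, ?_⟩
  have : ∀ᵐ θ ∂generatorLaw n d, ∀ k, θ k ∈ Set.Icc (-Real.pi) Real.pi :=
    ae_all_iff.2 fun k =>
      (Measure.tendsto_eval_ae_ae (μ := fun _ : GenParam n d => uniformAngle) (i := k)).eventually
        ae_mem_uniformAngle
  filter_upwards [this] with θ hθ using hC θ fun k _ => hθ k

theorem integrable_generatorLaw {n d : ℕ} {f : (GenParam n d → ℝ) → ℝ} (hf : Continuous f) :
    Integrable f (generatorLaw n d) := by
  obtain ⟨C, hC⟩ := exists_bound_generatorLaw hf
  exact Integrable.of_bound hf.aestronglyMeasurable C hC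

/-- Integrating out one angle. -/
theorem integral_generatorLaw_of_update {n d : ℕ} (k : GenParam n d)
    {f g : (GenParam n d → ℝ) → ℝ} (hf : Continuous f)
    (h : ∀ θ, ∫ t, f (Function.update θ k t) ∂uniformAngle = g θ) :
    ∫ θ, f θ ∂generatorLaw n d = ∫ θ, g θ ∂generatorLaw n d := by
  have := integral_pi_update (fun _ : GenParam n d => uniformAngle) k (integrable_generatorLaw hf)
  rw [generatorLaw, this]
  exact integral_congr_ae (ae_of_all _ h)

end Angles


/-! ### Fourier coefficients of weight one. -/

section FourierCoefficient

variable {n : ℕ}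

/-- The Fourier coefficient of a function on bit strings, as a linear functional. -/
noncomputable def fourierCoeff (α : Bits n) : (Bits n → ℝ) →ₗ[ℝ] ℝ where
  toFun f := (1 / 2 ^ n) * ∑ x : Bits n, (-1) ^ (∑ i, (α i).val * (x i).val) * f x
  map_add' f g := by simp [mul_add, Finset.sum_add_distrib]
  map_smul' r f := by
    simp only [Pi.smul_apply, smul_eq_mul, RingHom.id_apply, Finset.mul_sum]
    exact Finset.sum_congr rfl fun x _ => by ring

theorem fourierCoeff_apply (α : Bits n) (f : Bits n → ℝ) :
    fourierCoeff α f = (1 / 2 ^ n) * ∑ x : Bits n, (-1) ^ (∑ i, (α i).val * (x i).val) * f x := rfl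

theorem sum_single_mul_val (i : Fin n) (x : Bits n) :
    ∑ j, ((Pi.single i 1 : Bits n) j).val * (x j).val = (x i).val := by
  rw [Finset.sum_eq_single i]
  · simp
  · intro j _ hj
    simp [hj]
  · simp

/-- Flipping bit `i` is an involution, so summing over its pairs counts each string twice. -/
theorem sum_eq_of_flip (i : Fin n) {F : Bits n → ℝ} {r : ℝ}
    (h : ∀ x, F x + F (Function.update x i (x i + 1)) = 2 * r) :
    ∑ x, F x = 2 ^ n * r := by
  have hinv : Function.Involutive fun x : Bits n => Function.update x i (x i + 1) := by
    intro x
    simp only [Function.update_self, Function.update_idem]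
    rw [add_assoc, show (1 + 1 : Fin 2) = 0 from rfl, add_zero, Function.update_eq_self]
  have h1 : ∑ x, F (Function.update x i (x i + 1)) = ∑ x, F x := Equiv.sum_comp hinv.toPerm F
  have h2 : ∑ x, F x + ∑ x, F (Function.update x i (x i + 1)) = 2 ^ n * (2 * r) := by
    rw [← Finset.sum_add_distrib]
    simp [h]
  rw [h1] at h2
  linarith

theorem neg_one_pow_val_add_one (b : Fin 2) :
    (-1 : ℝ) ^ (b + 1).val = -(-1) ^ b.val := by
  fin_cases b <;> simp

/-- This is what removes the biases from the argument. -/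
theorem fourierCoeff_single_const (i : Fin n) (r : ℝ) :
    fourierCoeff (Pi.single i 1) (fun _ => r) = 0 := by
  rw [fourierCoeff_apply]
  simp_rw [sum_single_mul_val]
  rw [sum_eq_of_flip i (r := 0), mul_zero, mul_zero]
  intro x
  rw [Function.update_self, neg_one_pow_val_add_one]
  ring

theorem fourierCoeff_single_coord (i : Fin n) :
    fourierCoeff (Pi.single i 1) (fun x => ((x i).val : ℝ)) = -(1 / 2) := by
  rw [fourierCoeff_apply]
  simp_rw [sum_single_mul_val]
  rw [sum_eq_of_flip i (r := -(1 / 2))]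
  · field_simp
  · intro x
    rw [Function.update_self]
    generalize x i = b
    fin_cases b <;> norm_num

end FourierCoefficient

/-! ### Second moments through one random neuron. -/

section Neuron

theorem integral_eq_zero_of_map_neg {μ : Measure ℝ} (h : μ.map (fun t => -t) = μ) :
    ∫ t, t ∂μ = 0 := by
  have h1 : ∫ t, t ∂μ = ∫ t, -t ∂μ := by
    conv_lhs => rw [← h]
    exact integral_map_equiv (MeasurableEquiv.neg ℝ) (fun t => t)
  rw [integral_neg] at h1
  linarith

/-- The second moment of a linear form in independent centred variables. -/
theorem lintegral_linearForm_sq {m : ℕ} {μ : Measure ℝ} [IsProbabilityMeasure μ]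
    (hsymm : μ.map (fun t => -t) = μ) (hL2 : MemLp (fun t : ℝ => t) 2 μ) (a : Fin m → ℝ) :
    ∫⁻ w, ENNReal.ofReal ((∑ j, w j * a j) ^ 2) ∂(Measure.pi fun _ : Fin m => μ)
      = ENNReal.ofReal (Var[fun t : ℝ => t; μ] * ∑ j, a j ^ 2) := by
  have hj : ∀ j, MemLp (fun w : Fin m → ℝ => w j * a j) 2 (Measure.pi fun _ => μ) := fun j =>
    (hL2.comp_measurePreserving (measurePreserving_eval (fun _ : Fin m => μ) j)).mul_const (a j)
  have hs : MemLp (fun w : Fin m → ℝ => ∑ j, w j * a j) 2 (Measure.pi fun _ => μ) :=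
    memLp_finsetSum _ fun j _ => hj j
  have hvar : Var[∑ j, fun w : Fin m → ℝ => w j * a j; Measure.pi fun _ => μ]
      = ∑ j, Var[fun t : ℝ => t * a j; μ] :=
    variance_sum_pi (X := fun j t => t * a j) fun j => hL2.mul_const (a j)
  have hmean : ∫ w, (∑ j, fun w : Fin m → ℝ => w j * a j) w ∂(Measure.pi fun _ : Fin m => μ)
      = 0 := by
    simp only [Finset.sum_apply]
    rw [integral_finsetSum _ fun j _ => (hj j).integrable (by norm_num)]
    refine Finset.sum_eq_zero fun j _ => ?_
    rw [integral_mul_const]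
    have := integral_comp_eval (μ := fun _ : Fin m => μ) (i := j) (f := fun t : ℝ => t)
      hL2.aestronglyMeasurable
    rw [this, integral_eq_zero_of_map_neg hsymm, zero_mul]
  rw [variance_of_integral_eq_zero (by
    rw [show (∑ j, fun w : Fin m → ℝ => w j * a j) = fun w => ∑ j, w j * a j by
      ext w; simp]
    exact hs.aemeasurable) hmean] at hvar
  simp only [Finset.sum_apply] at hvar
  rw [← ofReal_integral_eq_lintegral_ofReal hs.integrable_sq (ae_of_all _ fun _ => sq_nonneg _),
    hvar, Finset.mul_sum]
  congr 1
  refine Finset.sum_congr rfl fun j _ => ?_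
  simp_rw [mul_comm _ (a j)]
  rw [variance_const_mul, mul_comm]

theorem enorm_sq_eq_ofReal (r : ℝ) : ‖r‖ₑ ^ 2 = ENNReal.ofReal (r ^ 2) := by
  rw [← enorm_pow, Real.enorm_of_nonneg (sq_nonneg r)]

/-- A neuron with random symmetric weights and bias, and an activation whose odd part is linear:
a linear functional that kills constants keeps a fixed fraction of its second moment. -/
theorem le_lintegral_neuron {X : Type*} [Finite X] {m : ℕ} {c : (X → ℝ) →ₗ[ℝ] ℝ}
    (hc : ∀ r, c (fun _ => r) = 0) {μ ν : Measure ℝ} [IsProbabilityMeasure μ]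
    [IsProbabilityMeasure ν] (hμ : μ.map (fun t => -t) = μ) (hν : ν.map (fun t => -t) = ν)
    (hL2 : MemLp (fun t : ℝ => t) 2 μ) {G : ℝ → ℝ} {κ : ℝ} (hG : Measurable G)
    (hodd : ∀ t, G t - G (-t) = 2 * κ * t) (v : Fin m → X → ℝ) :
    ENNReal.ofReal (κ ^ 2 * Var[fun t : ℝ => t; μ]) * ∑ j, ‖c (v j)‖ₑ ^ 2
      ≤ ∫⁻ p, ‖c (fun x => G (∑ j, p.1 j * v j x + p.2))‖ₑ ^ 2
          ∂(Measure.pi fun _ : Fin m => μ).prod ν := by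
  set P := (Measure.pi fun _ : Fin m => μ).prod ν
  set f : (Fin m → ℝ) × ℝ → ℝ := fun p => c (fun x => G (∑ j, p.1 j * v j x + p.2)) with hf
  have hcm : Measurable c := c.continuous_of_finiteDimensional.measurable
  have hfm : Measurable f := by
    refine hcm.comp (measurable_pi_lambda _ fun x => hG.comp ?_)
    fun_prop
  have hneg : MeasurePreserving (fun p : (Fin m → ℝ) × ℝ => (fun j => -p.1 j, -p.2)) P P :=
    (measurePreserving_pi _ _ fun _ => ⟨measurable_neg, hμ⟩).prod ⟨measurable_neg, hν⟩
  -- The even part of `G` cancels in the difference, and the bias drops out because `c` kills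
  -- constants.
  have hlin : ∀ p : (Fin m → ℝ) × ℝ,
      f p - f (fun j => -p.1 j, -p.2) = 2 * κ * ∑ j, p.1 j * c (v j) := by
    intro p
    have h1 : (fun x => G (∑ j, p.1 j * v j x + p.2))
        - (fun x => G (∑ j, -p.1 j * v j x + -p.2))
        = (2 * κ) • ((∑ j, p.1 j • v j) + fun _ => p.2) := by
      ext x
      have := hodd (∑ j, p.1 j * v j x + p.2)
      simp only [Pi.sub_apply, Pi.smul_apply, Pi.add_apply, Finset.sum_apply, smul_eq_mul,
        neg_mul, Finset.sum_neg_distrib]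
      rw [← this, neg_add]
    simp only [hf]
    rw [← map_sub, h1, map_smul, map_add, hc, map_sum]
    simp
  -- This is `(a - b)² ≤ 2a² + 2b²`. Working in `ℝ≥0∞` avoids any moment assumption on the bias; the
  -- two terms on the right then have equal integrals by sign symmetry.
  have hpt : ∀ p : (Fin m → ℝ) × ℝ,
      ENNReal.ofReal ((2 * κ) ^ 2) * ENNReal.ofReal ((∑ j, p.1 j * c (v j)) ^ 2)
        ≤ 2 * ‖f p‖ₑ ^ 2 + 2 * ‖f (fun j => -p.1 j, -p.2)‖ₑ ^ 2 := by
    intro p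
    rw [← ENNReal.ofReal_mul (sq_nonneg _), ← mul_pow, ← hlin, enorm_sq_eq_ofReal,
      enorm_sq_eq_ofReal, show (2 : ℝ≥0∞) = ENNReal.ofReal 2 by simp,
      ← ENNReal.ofReal_mul (by norm_num), ← ENNReal.ofReal_mul (by norm_num),
      ← ENNReal.ofReal_add (by positivity) (by positivity)]
    refine ENNReal.ofReal_le_ofReal ?_
    nlinarith [sq_nonneg (f p + f (fun j => -p.1 j, -p.2))]
  have hint := lintegral_mono (μ := P) hpt
  have hLform : Measurable fun w : Fin m → ℝ => ENNReal.ofReal ((∑ j, w j * c (v j)) ^ 2) := by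
    fun_prop
  have hfst : ∫⁻ p, ENNReal.ofReal ((∑ j, p.1 j * c (v j)) ^ 2) ∂P
      = ENNReal.ofReal (Var[fun t : ℝ => t; μ] * ∑ j, c (v j) ^ 2) := by
    rw [← lintegral_linearForm_sq hμ hL2]
    exact (measurePreserving_fst (μ := Measure.pi fun _ : Fin m => μ) (ν := ν)).lintegral_comp
      hLform
  have hm2 : Measurable fun p => 2 * ‖f p‖ₑ ^ 2 := (hfm.enorm.pow_const 2).const_mul 2
  rw [lintegral_const_mul _ (by exact hLform.comp measurable_fst), lintegral_add_left hm2,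
    hneg.lintegral_comp hm2, lintegral_const_mul _ (hfm.enorm.pow_const 2), hfst, ← add_mul] at hint
  have hsum : ∑ j, ‖c (v j)‖ₑ ^ 2 = ENNReal.ofReal (∑ j, c (v j) ^ 2) := by
    rw [ENNReal.ofReal_sum_of_nonneg fun _ _ => sq_nonneg _]
    exact Finset.sum_congr rfl fun j _ => enorm_sq_eq_ofReal _
  have h4 : ENNReal.ofReal ((2 * κ) ^ 2) * ENNReal.ofReal (Var[fun t : ℝ => t; μ] * ∑ j, c (v j) ^ 2)
      = 4 * (ENNReal.ofReal (κ ^ 2 * Var[fun t : ℝ => t; μ]) * ∑ j, ‖c (v j)‖ₑ ^ 2) := by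
    rw [hsum, ← ENNReal.ofReal_mul (sq_nonneg _),
      ← ENNReal.ofReal_mul (mul_nonneg (sq_nonneg _) (variance_nonneg _ _)),
      show (4 : ℝ≥0∞) = ENNReal.ofReal 4 by simp, ← ENNReal.ofReal_mul (by norm_num)]
    congr 1
    ring
  rw [h4, show (2 + 2 : ℝ≥0∞) = 4 by norm_num] at hint
  exact (ENNReal.mul_le_mul_iff_right (by norm_num) (by norm_num)).1 hint

end Neuron

/-! ### Odd parts and growth of the activations. -/

section Activations

/-- For `γ ≤ 1` the leaky ReLU is `(1 + γ)/2 · t + (1 - γ)/2 · |t|`. -/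
theorem leakyReLU_sub_neg (γ t : ℝ) (h : γ ≤ 1) :
    leakyReLU γ t - leakyReLU γ (-t) = 2 * ((1 + γ) / 2) * t := by
  unfold leakyReLU
  rcases le_total 0 t with ht | ht
  · rw [max_eq_left (by nlinarith), max_eq_right (by nlinarith)]
    ring
  · rw [max_eq_right (by nlinarith), max_eq_left (by nlinarith)]
    ring

theorem continuous_leakyReLU (γ : ℝ) : Continuous (leakyReLU γ) := by
  unfold leakyReLU
  fun_prop

theorem abs_leakyReLU_le {γ : ℝ} (h0 : 0 ≤ γ) (h1 : γ ≤ 1) (t : ℝ) : |leakyReLU γ t| ≤ |t| := by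
  unfold leakyReLU
  rcases le_total 0 t with ht | ht
  · rw [max_eq_left (by nlinarith)]
  · rw [max_eq_right (by nlinarith), abs_mul, abs_of_nonneg h0]
    exact mul_le_of_le_one_left (abs_nonneg t) h1

namespace GANKind

theorem continuous_activation (k : GANKind) : Continuous k.activation := by
  cases k with
  | minMax => exact continuous_sigmoid.log fun t => (Real.sigmoid_pos t).ne'
  | wasserstein => exact continuous_id

theorem log_sigmoid_sub_neg (t : ℝ) :
    Real.log (Real.sigmoid t) - Real.log (Real.sigmoid (-t)) = t := by
  rw [← Real.sigmoid_mul_rexp_neg, Real.log_mul (Real.sigmoid_pos t).ne' (Real.exp_pos _).ne',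
    Real.log_exp]
  ring

/-- The common bound `1 / 2 ≤ κ` lets both kinds of GAN share one proof. -/
theorem exists_activation_sub_neg (k : GANKind) :
    ∃ κ : ℝ, 1 / 2 ≤ κ ∧ ∀ t, k.activation t - k.activation (-t) = 2 * κ * t := by
  cases k with
  | minMax => exact ⟨1 / 2, le_rfl, fun t => by simp [activation, log_sigmoid_sub_neg]⟩
  | wasserstein => exact ⟨1, by norm_num, fun t => by simp only [activation]; ring⟩

/-- Linear growth transfers square integrability from the pre-activation to the output. -/
theorem abs_activation_le (k : GANKind) (t : ℝ) : |k.activation t| ≤ |t| + Real.log 2 := by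
  have hlog : 0 < Real.log 2 := Real.log_pos (by norm_num)
  cases k with
  | wasserstein => simp only [activation]; linarith
  | minMax =>
    have hpos : ∀ u : ℝ, 0 ≤ u → -Real.log 2 ≤ Real.log (Real.sigmoid u) := fun u hu => by
      rw [← Real.log_inv]
      refine Real.log_le_log (by norm_num) ?_
      rw [← Real.sigmoid_zero]
      exact Real.sigmoid_le hu
    have hneg : Real.log (Real.sigmoid t) ≤ 0 :=
      Real.log_nonpos (Real.sigmoid_nonneg t) (Real.sigmoid_le_one t)
    simp only [activation]
    rw [abs_of_nonpos hneg]
    rcases le_total 0 t with ht | ht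
    · linarith [hpos t ht, abs_nonneg t]
    · have := log_sigmoid_sub_neg t
      rw [abs_of_nonpos ht]
      linarith [hpos (-t) (by linarith)]

end GANKind

end Activations

/-! ### Layer structure and regularity of the discriminator. -/

namespace Discriminator

variable {n : ℕ} (D : Discriminator n)

/-- The law of the parameters of one hidden layer. -/
noncomputable abbrev layerLaw (l : Fin D.L) : Measure (D.HiddenParam l) :=
  (Measure.pi fun _ => Measure.pi fun _ => D.weightLaw l.castSucc).prod
    (Measure.pi fun _ => D.biasLaw l.castSucc)

/-- The law of the parameters of the output layer. -/
noncomputable abbrev outputLaw : Measure D.OutputParam :=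
  (Measure.pi fun _ => D.weightLaw (Fin.last D.L)).prod (D.biasLaw (Fin.last D.L))

theorem paramLaw_eq : D.paramLaw = (Measure.pi D.layerLaw).prod D.outputLaw := rfl

instance : IsProbabilityMeasure D.paramLaw := by
  rw [paramLaw_eq]; infer_instance

theorem neurons_zero (φ : D.Param) (x : Bits n) :
    D.neurons φ x 0 = fun i : Fin n => ((x i).val : ℝ) := rfl

theorem neurons_succ (φ : D.Param) (x : Bits n) (l : Fin D.L) :
    D.neurons φ x l.succ = fun i => leakyReLU (D.slope l)
      (∑ j, (φ.1 l).1 i j * D.neurons φ x l.castSucc j + (φ.1 l).2 i) := rfl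

/-- Makes the neurons entering a layer independent of that layer's parameters, and all neurons
independent of the output parameters. -/
theorem neurons_congr {φ ψ : D.Param} (x : Bits n) (l : Fin (D.L + 1))
    (h : ∀ l' : Fin D.L, l'.castSucc < l → φ.1 l' = ψ.1 l') :
    D.neurons φ x l = D.neurons ψ x l := by
  induction l using Fin.induction with
  | zero => rfl
  | succ l ih =>
    rw [neurons_succ, neurons_succ, h l l.castSucc_lt_succ,
      ih fun l' hl' => h l' (hl'.trans l.castSucc_lt_succ)]

theorem neurons_update {h : ∀ l, D.HiddenParam l} {o o' : D.OutputParam} (x : Bits n)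
    {l : Fin (D.L + 1)} {k : Fin D.L} (hk : l ≤ k.castSucc) (y : D.HiddenParam k) :
    D.neurons (Function.update h k y, o) x l = D.neurons (h, o') x l :=
  D.neurons_congr x l fun l' hl' => by
    have : l' ≠ k := by
      rintro rfl
      exact absurd (hl'.trans_le hk) (lt_irrefl _)
    simp [this]

theorem continuous_neurons (x : Bits n) (l : Fin (D.L + 1)) :
    Continuous fun φ : D.Param => D.neurons φ x l := by
  induction l using Fin.induction with
  | zero => exact continuous_const
  | succ l ih =>
    simp_rw [neurons_succ]
    refine continuous_pi fun i => (continuous_leakyReLU _).comp ?_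
    have := fun j => (continuous_apply j).comp ih
    simp only [Function.comp_def] at this
    fun_prop

theorem continuous_output (x : Bits n) : Continuous fun φ : D.Param => D.output φ x := by
  unfold output
  refine D.kind.continuous_activation.comp ?_
  have := fun j => (continuous_apply j).comp (D.continuous_neurons x (Fin.last D.L))
  simp only [Function.comp_def] at this
  fun_prop

theorem continuous_coeff (α : Bits n) : Continuous (D.coeff α) := by
  unfold coeff
  have := D.continuous_output
  fun_prop

theorem coeff_eq_fourierCoeff (α : Bits n) (φ : D.Param) :
    D.coeff α φ = fourierCoeff α fun x => D.output φ x := rfl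

theorem weightStd_sq (l : Fin (D.L + 1)) :
    D.weightStd l ^ 2 = Var[fun t : ℝ => t; D.weightLaw l] :=
  Real.sq_sqrt (variance_nonneg _ _)

/-! ### Power passed from the input to the output. -/

section LowerBound

variable {c : (Bits n → ℝ) →ₗ[ℝ] ℝ}

/-- The total power of a linear functional over the neurons of a layer. -/
noncomputable def layerPower (c : (Bits n → ℝ) →ₗ[ℝ] ℝ) (φ : D.Param) (l : Fin (D.L + 1)) :
    ℝ≥0∞ :=
  ∑ i, ‖c fun x => D.neurons φ x l i‖ₑ ^ 2

theorem measurable_layerPower (l : Fin (D.L + 1)) :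
    Measurable fun φ : D.Param => D.layerPower c φ l := by
  unfold layerPower
  refine Finset.measurable_sum _ fun i _ => ?_
  have hc : Continuous c := c.continuous_of_finiteDimensional
  have : Continuous fun φ : D.Param => c fun x => D.neurons φ x l i :=
    hc.comp (continuous_pi fun x => (continuous_apply i).comp (D.continuous_neurons x l))
  exact this.measurable.enorm.pow_const 2

theorem measurePreserving_row (l : Fin D.L) (i : Fin (D.width l.succ)) :
    MeasurePreserving (fun y : D.HiddenParam l => (y.1 i, y.2 i)) (D.layerLaw l)
      ((Measure.pi fun _ => D.weightLaw l.castSucc).prod (D.biasLaw l.castSucc)) :=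
  (measurePreserving_eval (fun _ : Fin (D.width l.succ) =>
      Measure.pi fun _ : Fin (D.width l.castSucc) => D.weightLaw l.castSucc) i).prod
    (measurePreserving_eval (fun _ : Fin (D.width l.succ) => D.biasLaw l.castSucc) i)

/-- The expected power does not decrease from one layer to the next. -/
theorem lintegral_layerPower_le_succ (hc : ∀ r, c (fun _ => r) = 0) (o : D.OutputParam)
    (l : Fin D.L) (hl : 4 ≤ (D.hiddenWidth l : ℝ) * D.weightStd l.castSucc ^ 2) :
    ∫⁻ h, D.layerPower c (h, o) l.castSucc ∂Measure.pi D.layerLaw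
      ≤ ∫⁻ h, D.layerPower c (h, o) l.succ ∂Measure.pi D.layerLaw := by
  have hm : Measurable fun h : ∀ l, D.HiddenParam l => D.layerPower c (h, o) l.succ :=
    (D.measurable_layerPower l.succ).comp (by fun_prop)
  rw [lintegral_pi_update D.layerLaw l hm]
  refine lintegral_mono fun h => ?_
  have hrow : ∀ i : Fin (D.width l.succ),
      ENNReal.ofReal (((1 + D.slope l) / 2) ^ 2 * Var[fun t : ℝ => t; D.weightLaw l.castSucc])
          * D.layerPower c (h, o) l.castSucc
        ≤ ∫⁻ y, ‖c fun x => D.neurons (Function.update h l y, o) x l.succ i‖ₑ ^ 2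
            ∂D.layerLaw l := by
    intro i
    refine (le_lintegral_neuron hc (D.weight_symm l.castSucc) (D.bias_symm l.castSucc)
      (D.weight_sq l.castSucc) (continuous_leakyReLU (D.slope l)).measurable
      (fun t => leakyReLU_sub_neg _ t (D.slope_le_one l))
      fun j x => D.neurons (h, o) x l.castSucc j).trans_eq ?_
    rw [← (D.measurePreserving_row l i).lintegral_comp]
    · refine lintegral_congr fun y => ?_
      simp only [neurons_succ, Function.update_self]
      simp_rw [D.neurons_update (o' := o) _ le_rfl y]
    · have hcm : Measurable c := c.continuous_of_finiteDimensional.measurable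
      refine Measurable.pow_const (Measurable.enorm (hcm.comp (measurable_pi_lambda _ fun x =>
        (continuous_leakyReLU (D.slope l)).measurable.comp ?_))) 2
      fun_prop
  -- Since `γ ≥ 0`, the squared odd slope is at least 1/4, which the bound 4 in the width condition
  -- exactly offsets.
  have hfac : 1 ≤ (D.hiddenWidth l : ℝ≥0∞) * ENNReal.ofReal
      (((1 + D.slope l) / 2) ^ 2 * Var[fun t : ℝ => t; D.weightLaw l.castSucc]) := by
    rw [← ENNReal.ofReal_natCast, ← ENNReal.ofReal_mul (Nat.cast_nonneg _), ENNReal.one_le_ofReal,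
      ← weightStd_sq]
    nlinarith [D.slope_nonneg l, sq_nonneg (D.slope l)]
  calc D.layerPower c (h, o) l.castSucc
      ≤ (D.hiddenWidth l : ℝ≥0∞) * ENNReal.ofReal
          (((1 + D.slope l) / 2) ^ 2 * Var[fun t : ℝ => t; D.weightLaw l.castSucc])
          * D.layerPower c (h, o) l.castSucc := le_mul_of_one_le_left' hfac
    _ = ∑ _i : Fin (D.width l.succ), ENNReal.ofReal
          (((1 + D.slope l) / 2) ^ 2 * Var[fun t : ℝ => t; D.weightLaw l.castSucc])
          * D.layerPower c (h, o) l.castSucc := by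
        rw [Finset.sum_const, Finset.card_univ, Fintype.card_fin, nsmul_eq_mul, mul_assoc]
        rfl
    _ ≤ ∑ i, ∫⁻ y, ‖c fun x => D.neurons (Function.update h l y, o) x l.succ i‖ₑ ^ 2
          ∂D.layerLaw l := Finset.sum_le_sum fun i _ => hrow i
    _ ≤ _ := by
        unfold layerPower
        rw [lintegral_finsetSum]
        intro i _
        have hcm : Continuous c := c.continuous_of_finiteDimensional
        have : Continuous fun y : D.HiddenParam l =>
            c fun x => D.neurons (Function.update h l y, o) x l.succ i :=
          hcm.comp (continuous_pi fun x => (continuous_apply i).comp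
            ((D.continuous_neurons x l.succ).comp
              ((continuous_const.update l continuous_id).prodMk continuous_const)))
        exact this.measurable.enorm.pow_const 2

theorem le_lintegral_layerPower
    (hwidth : ∀ l : Fin D.L, 4 ≤ (D.hiddenWidth l : ℝ) * D.weightStd l.castSucc ^ 2)
    (hc : ∀ r, c (fun _ => r) = 0) (o : D.OutputParam) (l : Fin (D.L + 1)) :
    ∑ i, ‖c fun x => ((x i).val : ℝ)‖ₑ ^ 2
      ≤ ∫⁻ h, D.layerPower c (h, o) l ∂Measure.pi D.layerLaw := by
  induction l using Fin.induction with
  | zero =>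
    simp_rw [layerPower, neurons_zero]
    rw [lintegral_const, measure_univ, mul_one]
    exact le_rfl
  | succ l ih => exact ih.trans (D.lintegral_layerPower_le_succ hc o l (hwidth l))

/-- The second moment of a Fourier coefficient of weight one of the discriminator. -/
theorem le_lintegral_coeff_sq
    (hwidth : ∀ l : Fin D.L, 4 ≤ (D.hiddenWidth l : ℝ) * D.weightStd l.castSucc ^ 2)
    {s : ℝ} (hs : 0 ≤ s) (hout : s ≤ D.weightStd (Fin.last D.L) ^ 2) (i : Fin n) :
    ENNReal.ofReal (s / 16) ≤ ∫⁻ φ, ‖D.coeff (Pi.single i 1) φ‖ₑ ^ 2 ∂D.paramLaw := by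
  set c := fourierCoeff (Pi.single i 1 : Bits n) with hcdef
  have hc : ∀ r, c (fun _ => r) = 0 := fourierCoeff_single_const i
  obtain ⟨κ, hκ, hodd⟩ := D.kind.exists_activation_sub_neg
  -- Input bit `i` alone has Fourier coefficient -1/2. The factor 1/16 in the conclusion is this 1/4
  -- times the 1/4 from `κ ≥ 1 / 2`.
  have hstart : ENNReal.ofReal (1 / 4) ≤ ∑ j, ‖c fun x => ((x j).val : ℝ)‖ₑ ^ 2 := by
    refine le_trans (le_of_eq ?_)
      (Finset.single_le_sum (fun _ _ => zero_le) (Finset.mem_univ i))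
    rw [hcdef, fourierCoeff_single_coord, enorm_sq_eq_ofReal]
    norm_num
  have hpow := hstart.trans (D.le_lintegral_layerPower hwidth hc (0, 0) (Fin.last D.L))
  have hm : Measurable fun φ : D.Param => ‖D.coeff (Pi.single i 1) φ‖ₑ ^ 2 :=
    (D.continuous_coeff _).measurable.enorm.pow_const 2
  rw [paramLaw_eq, lintegral_prod _ hm.aemeasurable]
  calc ENNReal.ofReal (s / 16)
      ≤ ENNReal.ofReal (κ ^ 2 * Var[fun t : ℝ => t; D.weightLaw (Fin.last D.L)])
          * ENNReal.ofReal (1 / 4) := by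
        rw [← ENNReal.ofReal_mul (mul_nonneg (sq_nonneg _) (variance_nonneg _ _))]
        refine ENNReal.ofReal_le_ofReal ?_
        rw [← weightStd_sq]
        nlinarith [mul_le_mul (show 1 / 4 ≤ κ ^ 2 by nlinarith) hout hs (sq_nonneg κ)]
    _ ≤ ENNReal.ofReal (κ ^ 2 * Var[fun t : ℝ => t; D.weightLaw (Fin.last D.L)])
          * ∫⁻ h, D.layerPower c (h, (0, 0)) (Fin.last D.L) ∂Measure.pi D.layerLaw := by
        gcongr
    _ = ∫⁻ h, ENNReal.ofReal (κ ^ 2 * Var[fun t : ℝ => t; D.weightLaw (Fin.last D.L)])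
          * D.layerPower c (h, (0, 0)) (Fin.last D.L) ∂Measure.pi D.layerLaw :=
        (lintegral_const_mul _ ((D.measurable_layerPower _).comp
          (by fun_prop : Measurable fun h : ∀ l, D.HiddenParam l =>
            (h, ((0, 0) : D.OutputParam))))).symm
    _ ≤ _ := by
        refine lintegral_mono fun h => ?_
        refine (le_lintegral_neuron hc (D.weight_symm _) (D.bias_symm (Fin.last D.L)) (D.weight_sq _)
          D.kind.continuous_activation.measurable hodd
          fun j x => D.neurons (h, (0, 0)) x (Fin.last D.L) j).trans_eq ?_
        refine lintegral_congr fun y => ?_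
        rw [coeff_eq_fourierCoeff]
        simp only [output]
        have : ∀ x, D.neurons (h, y) x (Fin.last D.L) = D.neurons (h, (0, 0)) x (Fin.last D.L) :=
          fun x => D.neurons_congr x _ fun _ _ => rfl
        simp_rw [this]
        rfl

end LowerBound

/-! ### Square integrability of the coefficients. -/

section SquareIntegrable

/-- Independence makes second moments multiply, so no fourth moments are needed. -/
theorem memLp_mul_prod {A B : Type*} [MeasurableSpace A] [MeasurableSpace B] {μ : Measure A}
    {ν : Measure B} [IsProbabilityMeasure μ] [IsProbabilityMeasure ν] {f : A → ℝ} {g : B → ℝ}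
    (hf : MemLp f 2 μ) (hg : MemLp g 2 ν) :
    MemLp (fun p : A × B => f p.1 * g p.2) 2 (μ.prod ν) := by
  have hm : AEStronglyMeasurable (fun p : A × B => f p.1 * g p.2) (μ.prod ν) :=
    (hf.aestronglyMeasurable.comp_fst).mul (hg.aestronglyMeasurable.comp_snd)
  rw [memLp_two_iff_integrable_sq hm]
  simp_rw [mul_pow]
  exact hf.integrable_sq.mul_prod hg.integrable_sq

theorem memLp_neurons (hb : ∀ l, MemLp (fun t : ℝ => t) 2 (D.biasLaw l)) (o : D.OutputParam)
    (x : Bits n) (l : Fin (D.L + 1)) (i : Fin (D.width l)) :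
    MemLp (fun h => D.neurons (h, o) x l i) 2 (Measure.pi D.layerLaw) := by
  induction l using Fin.induction with
  | zero =>
    simp_rw [neurons_zero]
    exact memLp_const _
  | succ l ih =>
    have hrow := D.measurePreserving_row l i
    have hw : ∀ j, MemLp (fun y : D.HiddenParam l => y.1 i j) 2 (D.layerLaw l) := fun j =>
      (((D.weight_sq l.castSucc).comp_measurePreserving
        (measurePreserving_eval (fun _ => D.weightLaw l.castSucc) j)).comp_measurePreserving
          measurePreserving_fst).comp_measurePreserving hrow
    have hbias : MemLp (fun y : D.HiddenParam l => y.2 i) 2 (D.layerLaw l) :=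
      ((hb l.castSucc).comp_measurePreserving measurePreserving_snd).comp_measurePreserving hrow
    have hpre : MemLp (fun p : (∀ l, D.HiddenParam l) × D.HiddenParam l =>
        ∑ j, D.neurons (p.1, o) x l.castSucc j * p.2.1 i j + p.2.2 i) 2
        ((Measure.pi D.layerLaw).prod (D.layerLaw l)) :=
      (memLp_finsetSum _ fun j _ => memLp_mul_prod (ih j) (hw j)).add
        (hbias.comp_measurePreserving measurePreserving_snd)
    have hcont : Continuous fun h : ∀ l, D.HiddenParam l => D.neurons (h, o) x l.succ i :=
      (continuous_apply i).comp ((D.continuous_neurons x l.succ).comp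
        (continuous_id.prodMk continuous_const))
    -- Resampling layer `l` puts its weights and the preceding neurons on separate factors of a
    -- product measure.
    rw [← (measurePreserving_update_pi D.layerLaw l).map_eq,
      memLp_map_measure_iff hcont.aestronglyMeasurable measurable_update'.aemeasurable]
    refine hpre.mono (hcont.measurable.comp measurable_update').aestronglyMeasurable
      (ae_of_all _ fun p => ?_)
    simp only [Function.comp_apply, neurons_succ, Function.update_self,
      D.neurons_update (o' := o) x le_rfl]
    rw [Real.norm_eq_abs, Real.norm_eq_abs]
    refine (abs_leakyReLU_le (D.slope_nonneg l) (D.slope_le_one l) _).trans_eq ?_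
    simp_rw [mul_comm]

theorem memLp_output (hb : ∀ l, MemLp (fun t : ℝ => t) 2 (D.biasLaw l)) (x : Bits n) :
    MemLp (fun φ => D.output φ x) 2 D.paramLaw := by
  have hw : ∀ j, MemLp (fun y : D.OutputParam => y.1 j) 2 D.outputLaw := fun j =>
    ((D.weight_sq _).comp_measurePreserving
      (measurePreserving_eval (fun _ => D.weightLaw (Fin.last D.L)) j)).comp_measurePreserving
        measurePreserving_fst
  have hbias : MemLp (fun y : D.OutputParam => y.2) 2 D.outputLaw :=
    (hb _).comp_measurePreserving measurePreserving_snd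
  have hpre : MemLp (fun φ : D.Param =>
      |∑ j, D.neurons (φ.1, (0, 0)) x (Fin.last D.L) j * φ.2.1 j + φ.2.2| + Real.log 2) 2
      D.paramLaw :=
    (((memLp_finsetSum _ fun j _ =>
      memLp_mul_prod (D.memLp_neurons hb (0, 0) x (Fin.last D.L) j) (hw j)).add
        (hbias.comp_measurePreserving measurePreserving_snd)).abs).add (memLp_const _)
  refine hpre.mono (D.continuous_output x).aestronglyMeasurable (ae_of_all _ fun φ => ?_)
  have : D.neurons φ x (Fin.last D.L) = D.neurons (φ.1, (0, 0)) x (Fin.last D.L) :=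
    D.neurons_congr x _ fun _ _ => rfl
  simp only [output, this, Real.norm_eq_abs]
  refine (D.kind.abs_activation_le _).trans (le_trans (le_of_eq ?_) (le_abs_self _))
  simp_rw [mul_comm]

theorem memLp_coeff (hb : ∀ l, MemLp (fun t : ℝ => t) 2 (D.biasLaw l)) (α : Bits n) :
    MemLp (D.coeff α) 2 D.paramLaw := by
  unfold coeff
  exact (memLp_finsetSum _ fun x _ => (D.memLp_output hb x).const_mul _).const_mul _

end SquareIntegrable

end Discriminator

/-! ### Tensor products and conjugation by single-qubit rotations. -/

section TensorOperators

variable {n : ℕ}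

theorem tensorOp_mul (A B : Fin n → Matrix (Fin 2) (Fin 2) ℂ) :
    tensorOp A * tensorOp B = tensorOp fun i => A i * B i := by
  ext x z
  simp only [tensorOp, Matrix.mul_apply, Matrix.of_apply, ← Finset.prod_mul_distrib]
  rw [Finset.prod_univ_sum, Fintype.piFinset_univ]

theorem tensorOp_conjTranspose (A : Fin n → Matrix (Fin 2) (Fin 2) ℂ) :
    (tensorOp A)ᴴ = tensorOp fun i => (A i)ᴴ := by
  ext x y
  simp [tensorOp, Matrix.conjTranspose_apply]

theorem tensorOp_update (A : Fin n → Matrix (Fin 2) (Fin 2) ℂ) (i : Fin n) (a b : ℂ)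
    (P Q : Matrix (Fin 2) (Fin 2) ℂ) :
    tensorOp (Function.update A i (a • P + b • Q))
      = a • tensorOp (Function.update A i P) + b • tensorOp (Function.update A i Q) := by
  have h : ∀ (M : Matrix (Fin 2) (Fin 2) ℂ) (x y : Bits n),
      tensorOp (Function.update A i M) x y
        = M (x i) (y i) * ∏ j ∈ Finset.univ.erase i, A j (x j) (y j) := by
    intro M x y
    simp only [tensorOp, Matrix.of_apply]
    rw [← Finset.mul_prod_erase _ _ (Finset.mem_univ i), Function.update_self]
    congr 1
    refine Finset.prod_congr rfl fun j hj => ?_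
    rw [Function.update_of_ne (Finset.ne_of_mem_erase hj)]
  ext x y
  simp only [Matrix.add_apply, Matrix.smul_apply, h, smul_eq_mul]
  ring

/-- The Pauli matrix `X`. -/
def pauliX : Matrix (Fin 2) (Fin 2) ℂ := !![0, 1; 1, 0]

theorem rotZ_conj_one (s : ℝ) : (rotZ s)ᴴ * rotZ s = 1 := by
  ext i j
  fin_cases i <;> fin_cases j <;>
    simp [rotZ, Matrix.mul_apply, Fin.sum_univ_two, ← Complex.exp_conj, ← Complex.exp_add,
      map_ofNat, neg_div]

theorem rotZ_conj_pauliZ (s : ℝ) : (rotZ s)ᴴ * pauliZ * rotZ s = pauliZ := by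
  ext i j
  fin_cases i <;> fin_cases j <;>
    simp [rotZ, pauliZ, Matrix.mul_apply, Fin.sum_univ_two, ← Complex.exp_conj, ← Complex.exp_add,
      map_ofNat, neg_div]

theorem rotY_conj_one (t : ℝ) : (rotY t)ᴴ * rotY t = 1 := by
  have h : (Real.cos (t / 2) : ℂ) * Real.cos (t / 2) + Real.sin (t / 2) * Real.sin (t / 2) = 1 := by
    norm_cast
    nlinarith [Real.sin_sq_add_cos_sq (t / 2)]
  ext i j
  fin_cases i <;> fin_cases j <;>
    simp only [rotY, Matrix.mul_apply, Fin.sum_univ_two, Matrix.conjTranspose_apply] <;>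
    simp [Complex.conj_ofReal, -Complex.ofReal_cos, -Complex.ofReal_sin] <;>
    first
      | linear_combination h
      | ring

theorem rotY_conj_pauliZ (t : ℝ) :
    (rotY t)ᴴ * pauliZ * rotY t = (Real.cos t : ℂ) • pauliZ + (-Real.sin t : ℂ) • pauliX := by
  have hc : (Real.cos t : ℂ)
      = Real.cos (t / 2) * Real.cos (t / 2) - Real.sin (t / 2) * Real.sin (t / 2) := by
    rw [show t = 2 * (t / 2) by ring, Real.cos_two_mul']
    push_cast
    ring_nf
  have hs : (Real.sin t : ℂ) = 2 * Real.sin (t / 2) * Real.cos (t / 2) := by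
    rw [show t = 2 * (t / 2) by ring, Real.sin_two_mul]
    push_cast
    ring_nf
  rw [hc, hs]
  ext i j
  fin_cases i <;> fin_cases j <;>
    simp [rotY, pauliZ, pauliX, Matrix.mul_apply, Fin.sum_univ_two, Complex.conj_ofReal,
      -Complex.ofReal_cos, -Complex.ofReal_sin] <;> ring

end TensorOperators

/-! ### Invariance of `Z` on the first qubit under the entangler. -/

section Entangler

variable {n : ℕ}

theorem pauliZString_single_eq_diagonal (i : Fin n) :
    pauliZString (Pi.single i 1 : Bits n)
      = Matrix.diagonal fun x => if x i = 1 then -1 else 1 := by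
  ext x y
  simp only [pauliZString, tensorOp, Matrix.of_apply, Matrix.diagonal_apply]
  split_ifs with h h1
  · subst h
    rw [Finset.prod_eq_single i]
    · simp [h1, pauliZ]
    · intro j _ hj
      simp [hj]
    · simp
  · subst h
    rw [Finset.prod_eq_single i]
    · have : x i = 0 := by omega
      simp [this, pauliZ]
    · intro j _ hj
      simp [hj]
    · simp
  · obtain ⟨j, hj⟩ := Function.ne_iff.1 h
    refine Finset.prod_eq_zero (Finset.mem_univ j) ?_
    split_ifs
    · generalize x j = a at *
      generalize y j = b at *
      fin_cases a <;> fin_cases b <;> simp_all [pauliZ]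
    · exact Matrix.one_apply_ne hj

/-- A CNOT gate does not affect a `Z` on a qubit that is not its target. -/
theorem cnot_conj_pauliZString {c t i : Fin n} (hct : c ≠ t) (hi : i ≠ t) :
    (cnot c t)ᴴ * pauliZString (Pi.single i 1) * cnot c t = pauliZString (Pi.single i 1) := by
  have hinv : Function.Involutive fun y : Bits n => Function.update y t (y t + y c) := by
    intro y
    have : y t + y c + y c = y t := by
      rw [add_assoc]
      generalize y c = b
      fin_cases b <;> simp
    simp [Function.update_of_ne hct, this]
  -- A CNOT is a permutation matrix, so it only permutes the diagonal entries, and the permutation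
  -- leaves bit `i` unchanged.
  rw [pauliZString_single_eq_diagonal]
  ext x y
  rw [Matrix.mul_apply]
  simp only [Matrix.mul_diagonal, Matrix.conjTranspose_apply, cnot, Matrix.of_apply]
  rw [Finset.sum_eq_single (Function.update y t (y t + y c))]
  · rw [if_pos rfl, mul_one, Function.update_of_ne hi, Matrix.diagonal_apply]
    by_cases hxy : x = y
    · subst hxy
      simp
    · rw [if_neg hxy, if_neg]
      · simp
      · intro h
        exact hxy (hinv.injective h).symm
  · intro z _ hz
    rw [if_neg hz, mul_zero]
  · simp

theorem conj_list_prod {M : Op n} (l : List (Op n)) (h : ∀ A ∈ l, Aᴴ * M * A = M) :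
    l.prodᴴ * M * l.prod = M := by
  induction l with
  | nil => simp
  | cons A l ih =>
    rw [List.prod_cons, Matrix.conjTranspose_mul]
    calc l.prodᴴ * Aᴴ * M * (A * l.prod) = l.prodᴴ * (Aᴴ * M * A) * l.prod := by
          simp only [Matrix.mul_assoc]
      _ = M := by
        rw [h A List.mem_cons_self]
        exact ih fun B hB => h B (List.mem_cons_of_mem _ hB)

/-- Every target has the form `j + 1`, so qubit 0 can only be a control. -/
theorem cnotLayer_conj_pauliZString {i : Fin n} (hi : i.val = 0) (p : ℕ) :
    (cnotLayer n p)ᴴ * pauliZString (Pi.single i 1) * cnotLayer n p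
      = pauliZString (Pi.single i 1) := by
  refine conj_list_prod _ fun A hA => ?_
  obtain ⟨j, -, rfl⟩ := List.mem_map.1 hA
  split_ifs
  · refine cnot_conj_pauliZString ?_ ?_ <;> simp [Fin.ext_iff, hi]
  · simp

/-- The pairwise entangler does not affect a `Z` on the first qubit. -/
theorem pairwiseEntangler_conj_pauliZString {i : Fin n} (hi : i.val = 0) :
    (pairwiseEntangler n)ᴴ * pauliZString (Pi.single i 1) * pairwiseEntangler n
      = pauliZString (Pi.single i 1) := by
  rw [pairwiseEntangler, Matrix.conjTranspose_mul]
  calc (cnotLayer n 0)ᴴ * (cnotLayer n 1)ᴴ * pauliZString (Pi.single i 1)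
        * (cnotLayer n 1 * cnotLayer n 0)
      = (cnotLayer n 0)ᴴ * ((cnotLayer n 1)ᴴ * pauliZString (Pi.single i 1) * cnotLayer n 1)
        * cnotLayer n 0 := by simp only [Matrix.mul_assoc]
    _ = _ := by rw [cnotLayer_conj_pauliZString hi, cnotLayer_conj_pauliZString hi]

end Entangler

/-! ### The circuit layer by layer, as a function of one angle. -/

section Circuit

variable {n d : ℕ}

/-- The state of the circuit right before the `l`-th rotation layer. -/
noncomputable def preState (θ : GenParam n d → ℝ) (l : Fin (d + 1)) : Op n :=
  Fin.induction (motive := fun _ => Op n) (zeroState n)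
    (fun l S => pairwiseEntangler n * (rotationLayer θ l.castSucc * S *
      (rotationLayer θ l.castSucc)ᴴ) * (pairwiseEntangler n)ᴴ) l

theorem preState_zero (θ : GenParam n d → ℝ) : preState θ 0 = zeroState n := rfl

theorem preState_succ (θ : GenParam n d → ℝ) (l : Fin d) :
    preState θ l.succ = pairwiseEntangler n * (rotationLayer θ l.castSucc * preState θ l.castSucc *
      (rotationLayer θ l.castSucc)ᴴ) * (pairwiseEntangler n)ᴴ := rfl

/-- Isolates one rotation layer, so that its angles can be averaged against a state depending only
on earlier layers. -/
theorem circuit_conj_zeroState (θ : GenParam n d → ℝ) (l : Fin (d + 1)) :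
    Fin.induction (motive := fun _ => Op n) (rotationLayer θ 0)
        (fun l U => rotationLayer θ l.succ * pairwiseEntangler n * U) l * zeroState n *
      (Fin.induction (motive := fun _ => Op n) (rotationLayer θ 0)
        (fun l U => rotationLayer θ l.succ * pairwiseEntangler n * U) l)ᴴ
      = rotationLayer θ l * preState θ l * (rotationLayer θ l)ᴴ := by
  induction l using Fin.induction with
  | zero => rfl
  | succ l ih =>
    rw [preState_succ, ← ih, Fin.induction_succ]
    simp only [Matrix.conjTranspose_mul, Matrix.mul_assoc]

theorem preState_congr {θ θ' : GenParam n d → ℝ} (l : Fin (d + 1))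
    (h : ∀ l' < l, ∀ j b, θ (l', j, b) = θ' (l', j, b)) : preState θ l = preState θ' l := by
  induction l using Fin.induction with
  | zero => rw [preState_zero, preState_zero]
  | succ l ih =>
    have hl := h l.castSucc l.castSucc_lt_succ
    rw [preState_succ θ l, preState_succ θ' l, ih fun l' hl' => h l' (hl'.trans l.castSucc_lt_succ)]
    simp only [rotationLayer, hl]

/-- `Z_α` conjugated by a rotation layer. -/
noncomputable def rotatedPauli (θ : GenParam n d → ℝ) (l : Fin (d + 1)) (α : Bits n) :
    Fin n → Matrix (Fin 2) (Fin 2) ℂ :=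
  fun i => if α i = 1 then
    (Real.cos (θ (l, i, 0)) : ℂ) • pauliZ + (-Real.sin (θ (l, i, 0)) : ℂ) • pauliX else 1

theorem rotationLayer_conj_pauliZString (θ : GenParam n d → ℝ) (l : Fin (d + 1)) (α : Bits n) :
    (rotationLayer θ l)ᴴ * pauliZString α * rotationLayer θ l
      = tensorOp (rotatedPauli θ l α) := by
  simp only [rotationLayer, pauliZString, tensorOp_mul, tensorOp_conjTranspose]
  congr 1
  ext1 i
  rw [Matrix.conjTranspose_mul]
  unfold rotatedPauli
  split_ifs
  · rw [← rotY_conj_pauliZ]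
    conv_rhs => rw [← rotZ_conj_pauliZ (θ (l, i, 1))]
    simp only [Matrix.mul_assoc]
  · rw [Matrix.mul_one, Matrix.mul_assoc, ← Matrix.mul_assoc (rotZ _)ᴴ, rotZ_conj_one,
      Matrix.one_mul, rotY_conj_one]

theorem trace_rotationLayer (θ : GenParam n d → ℝ) (l : Fin (d + 1)) (α : Bits n) (S : Op n) :
    Matrix.trace (rotationLayer θ l * S * (rotationLayer θ l)ᴴ * pauliZString α)
      = Matrix.trace (S * tensorOp (rotatedPauli θ l α)) := by
  rw [← rotationLayer_conj_pauliZString, Matrix.mul_assoc, Matrix.mul_assoc, Matrix.trace_mul_comm]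
  simp only [Matrix.mul_assoc]

theorem pauliLoss_eq (α : Bits n) (θ : GenParam n d → ℝ) :
    pauliLoss α θ = (Matrix.trace (preState θ (Fin.last d) *
      tensorOp (rotatedPauli θ (Fin.last d) α))).re := by
  rw [← trace_rotationLayer, ← circuit_conj_zeroState]
  rfl

theorem re_trace_mul_add_smul (S P Q : Op n) (a b : ℝ) :
    (Matrix.trace (S * ((a : ℂ) • P + (b : ℂ) • Q))).re
      = a * (Matrix.trace (S * P)).re + b * (Matrix.trace (S * Q)).re := by
  rw [Matrix.mul_add, Matrix.mul_smul, Matrix.mul_smul, Matrix.trace_add, Matrix.trace_smul,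
    Matrix.trace_smul]
  simp only [smul_eq_mul, Complex.add_re, Complex.re_ofReal_mul]

/-- The expectation of a Pauli string after a rotation layer, as a function of a single
`R_Y` angle of that layer. -/
theorem re_trace_rotatedPauli_of_eq_one (θ : GenParam n d → ℝ) (l : Fin (d + 1)) {α : Bits n}
    {i : Fin n} (hi : α i = 1) (S : Op n) :
    (Matrix.trace (S * tensorOp (rotatedPauli θ l α))).re
      = Real.cos (θ (l, i, 0)) * (Matrix.trace (S * tensorOp
          (Function.update (rotatedPauli θ l α) i pauliZ))).re
        - Real.sin (θ (l, i, 0)) * (Matrix.trace (S * tensorOp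
          (Function.update (rotatedPauli θ l α) i pauliX))).re := by
  have h : rotatedPauli θ l α = Function.update (rotatedPauli θ l α) i
      (((Real.cos (θ (l, i, 0)) : ℝ) : ℂ) • pauliZ + ((-Real.sin (θ (l, i, 0)) : ℝ) : ℂ) • pauliX) := by
    refine (Function.update_eq_self_iff.2 ?_).symm
    simp [rotatedPauli, hi]
  conv_lhs => rw [h, tensorOp_update, re_trace_mul_add_smul]
  ring

theorem rotatedPauli_congr {θ θ' : GenParam n d → ℝ} {l : Fin (d + 1)} {α : Bits n} {j : Fin n}
    (h : α j = 1 → θ (l, j, 0) = θ' (l, j, 0)) : rotatedPauli θ l α j = rotatedPauli θ' l α j := by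
  unfold rotatedPauli
  split_ifs with hj
  · rw [h hj]
  · rfl

theorem preState_update (θ : GenParam n d → ℝ) {l l' : Fin (d + 1)} (hl : l ≤ l') (i : Fin n)
    (b : Fin 2) (t : ℝ) : preState (Function.update θ (l', i, b) t) l = preState θ l := by
  refine preState_congr l fun m hm j c => ?_
  rw [Function.update_of_ne]
  rintro h
  simp only [Prod.mk.injEq] at h
  exact absurd (h.1 ▸ hm.trans_le hl) (lt_irrefl _)

theorem pauliLoss_update_of_eq_zero {α : Bits n} {i : Fin n} (hi : α i = 0)
    (θ : GenParam n d → ℝ) (t : ℝ) :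
    pauliLoss α (Function.update θ (Fin.last d, i, 0) t) = pauliLoss α θ := by
  rw [pauliLoss_eq, pauliLoss_eq, preState_update θ le_rfl]
  congr 4
  ext1 j
  refine rotatedPauli_congr fun hj => ?_
  rw [Function.update_of_ne]
  rintro h
  simp only [Prod.mk.injEq] at h
  simp [h.2.1, hi] at hj

/-- The absence of a constant term is the point: the average over this angle vanishes. -/
theorem exists_pauliLoss_update_of_eq_one {α : Bits n} {i : Fin n} (hi : α i = 1)
    (θ : GenParam n d → ℝ) :
    ∃ p q : ℝ, ∀ t, pauliLoss α (Function.update θ (Fin.last d, i, 0) t)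
      = p * Real.cos t + q * Real.sin t := by
  refine ⟨(Matrix.trace (preState θ (Fin.last d) * tensorOp
      (Function.update (rotatedPauli θ (Fin.last d) α) i pauliZ))).re,
    -(Matrix.trace (preState θ (Fin.last d) * tensorOp
      (Function.update (rotatedPauli θ (Fin.last d) α) i pauliX))).re, fun t => ?_⟩
  have hrest : ∀ M : Matrix (Fin 2) (Fin 2) ℂ,
      Function.update (rotatedPauli (Function.update θ (Fin.last d, i, 0) t) (Fin.last d) α) i M
        = Function.update (rotatedPauli θ (Fin.last d) α) i M := by
    intro M
    ext1 j
    by_cases hj : j = i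
    · subst hj; simp
    · rw [Function.update_of_ne hj, Function.update_of_ne hj]
      refine rotatedPauli_congr fun _ => ?_
      rw [Function.update_of_ne]
      simp [hj]
  rw [pauliLoss_eq, re_trace_rotatedPauli_of_eq_one _ _ hi, preState_update θ le_rfl, hrest, hrest,
    Function.update_self]
  ring

theorem exists_pauliLoss_update (α : Bits n) (i : Fin n) (θ : GenParam n d → ℝ) :
    ∃ a p q : ℝ, ∀ t, pauliLoss α (Function.update θ (Fin.last d, i, 0) t)
      = a + p * Real.cos t + q * Real.sin t := by
  rcases (by omega : α i = 0 ∨ α i = 1) with hi | hi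
  · exact ⟨pauliLoss α θ, 0, 0, fun t => by rw [pauliLoss_update_of_eq_zero hi]; ring⟩
  · obtain ⟨p, q, h⟩ := exists_pauliLoss_update_of_eq_one hi θ
    exact ⟨0, p, q, fun t => by rw [h]; ring⟩

theorem continuous_rotationLayer (l : Fin (d + 1)) :
    Continuous fun θ : GenParam n d → ℝ => rotationLayer θ l := by
  have ht : ∀ (A : (GenParam n d → ℝ) → Fin n → Matrix (Fin 2) (Fin 2) ℂ),
      (∀ i a b, Continuous fun θ => A θ i a b) → Continuous fun θ => tensorOp (A θ) := by
    intro A hA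
    refine continuous_matrix fun x y => ?_
    simp only [tensorOp, Matrix.of_apply]
    exact continuous_finsetProd _ fun i _ => hA i _ _
  refine (ht _ fun i a b => ?_).matrix_mul (ht _ fun i a b => ?_)
  · fin_cases a <;> fin_cases b <;> simp [rotZ] <;> fun_prop
  · fin_cases a <;> fin_cases b <;> simp [rotY] <;> fun_prop

theorem continuous_preState (l : Fin (d + 1)) :
    Continuous fun θ : GenParam n d → ℝ => preState θ l := by
  induction l using Fin.induction with
  | zero => exact continuous_const
  | succ l ih =>
    simp_rw [preState_succ]
    have hr := continuous_rotationLayer (n := n) l.castSucc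
    exact (continuous_const.matrix_mul ((hr.matrix_mul ih).matrix_mul
      hr.matrix_conjTranspose)).matrix_mul continuous_const

theorem continuous_pauliLoss (α : Bits n) :
    Continuous fun θ : GenParam n d → ℝ => pauliLoss α θ := by
  have h : ∀ θ : GenParam n d → ℝ, pauliLoss α θ = (Matrix.trace (rotationLayer θ (Fin.last d) *
      preState θ (Fin.last d) * (rotationLayer θ (Fin.last d))ᴴ * pauliZString α)).re := fun θ => by
    rw [trace_rotationLayer, pauliLoss_eq]
  simp_rw [h]
  have hr := continuous_rotationLayer (n := n) (Fin.last d)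
  exact Complex.continuous_re.comp
    (((hr.matrix_mul (continuous_preState _)).matrix_mul hr.matrix_conjTranspose).matrix_mul
      continuous_const).matrix_trace

end Circuit


/-! ### Test functions detecting a single `Z` and its derivative. -/

section TestFunctions

variable {n d : ℕ}

/-- The product of the cosines of the `R_Y` angles of qubit `i` before the `l`-th rotation layer. -/
noncomputable def cosProd (i : Fin n) (l : Fin (d + 1)) (θ : GenParam n d → ℝ) : ℝ :=
  ∏ m ∈ Finset.Iio l, Real.cos (θ (m, i, 0))

theorem continuous_cosProd (i : Fin n) (l : Fin (d + 1)) :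
    Continuous (cosProd i l) := by
  unfold cosProd
  fun_prop

theorem abs_cosProd_le_one (i : Fin n) (l : Fin (d + 1)) (θ : GenParam n d → ℝ) :
    |cosProd i l θ| ≤ 1 := by
  rw [cosProd, Finset.abs_prod]
  exact Finset.prod_le_one (fun _ _ => abs_nonneg _) fun _ _ => Real.abs_cos_le_one _

theorem cosProd_succ (i : Fin n) (l : Fin d) (θ : GenParam n d → ℝ) :
    cosProd i l.succ θ = Real.cos (θ (l.castSucc, i, 0)) * cosProd i l.castSucc θ := by
  have : Finset.Iio l.succ = insert l.castSucc (Finset.Iio l.castSucc) := by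
    ext m
    simp only [Finset.mem_Iio, Finset.mem_insert, Fin.lt_def, Fin.ext_iff, Fin.val_succ,
      Fin.val_castSucc]
    omega
  rw [cosProd, this, Finset.prod_insert (by simp), cosProd]

theorem cosProd_update (θ : GenParam n d → ℝ) (i j : Fin n) {l l' : Fin (d + 1)}
    (h : l ≤ l' ∨ j ≠ i) (t : ℝ) :
    cosProd i l (Function.update θ (l', j, 0) t) = cosProd i l θ := by
  refine Finset.prod_congr rfl fun m hm => ?_
  rw [Function.update_of_ne]
  intro hne
  simp only [Prod.mk.injEq, and_true] at hne
  rcases h with h | h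
  · exact absurd (hne.1 ▸ (Finset.mem_Iio.1 hm).trans_le h) (lt_irrefl _)
  · exact h hne.2.symm

theorem cosProd_zero (i : Fin n) (θ : GenParam n d → ℝ) : cosProd i 0 θ = 1 := by
  have : Finset.Iio (0 : Fin (d + 1)) = ∅ := by
    ext m
    simp
  rw [cosProd, this, Finset.prod_empty]

/-- The expectation of `Z` on qubit `i` after a rotation layer, tested against the cosine of the
angle of the layer. -/
theorem integral_layer_mul_cosProd (i : Fin n) (l : Fin (d + 1)) :
    ∫ θ : GenParam n d → ℝ, (Matrix.trace (rotationLayer θ l * preState θ l * (rotationLayer θ l)ᴴ *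
        pauliZString (Pi.single i 1))).re * (Real.cos (θ (l, i, 0)) * cosProd i l θ)
        ∂generatorLaw n d
      = 1 / 2 * ∫ θ : GenParam n d → ℝ, (Matrix.trace (preState θ l *
          pauliZString (Pi.single i 1))).re * cosProd i l θ ∂generatorLaw n d := by
  rw [← integral_const_mul]
  refine integral_generatorLaw_of_update (l, i, 0) ?_ fun θ => ?_
  · have hr := continuous_rotationLayer (n := n) l
    have hc := continuous_cosProd i l
    have : Continuous fun θ : GenParam n d → ℝ => (Matrix.trace (rotationLayer θ l * preState θ l *
        (rotationLayer θ l)ᴴ * pauliZString (Pi.single i 1))).re :=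
      Complex.continuous_re.comp
        (((hr.matrix_mul (continuous_preState _)).matrix_mul hr.matrix_conjTranspose).matrix_mul
          continuous_const).matrix_trace
    fun_prop
  · set S := preState θ l
    have hupd : ∀ (t : ℝ) (M : Matrix (Fin 2) (Fin 2) ℂ),
        Function.update (rotatedPauli (Function.update θ (l, i, 0) t) l (Pi.single i 1)) i M
          = Function.update (fun _ => 1) i M := by
      intro t M
      ext1 j
      by_cases hj : j = i
      · subst hj; simp
      · rw [Function.update_of_ne hj, Function.update_of_ne hj]
        simp [rotatedPauli, hj]
    have hZ : tensorOp (Function.update (fun _ => 1) i pauliZ)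
        = pauliZString (Pi.single i 1 : Bits n) := by
      unfold pauliZString
      congr 1
      ext1 j
      by_cases hj : j = i
      · subst hj; simp
      · simp [hj]
    simp_rw [trace_rotationLayer, re_trace_rotatedPauli_of_eq_one _ l
      (Pi.single_eq_same i 1 : (Pi.single i 1 : Bits n) i = 1), hupd, hZ,
      preState_update θ le_rfl, cosProd_update θ i i (Or.inl le_rfl), Function.update_self]
    set p := (Matrix.trace (S * pauliZString (Pi.single i 1))).re
    set q := (Matrix.trace (S * tensorOp (Function.update (fun _ => 1) i pauliX))).re
    -- The earlier state and cosines do not involve this angle. The `X` term is orthogonal to the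
    -- cosine, and the `Z` term leaves the factor 1/2.
    have := integral_trig_uniformAngle 0 p (-q) (cosProd i l θ) 0
    rw [show 1 / 2 * (p * cosProd i l θ) = (p * cosProd i l θ + -q * 0) / 2 by ring, ← this]
    congr 1
    ext t
    ring

theorem re_trace_preState_zero (i : Fin n) (θ : GenParam n d → ℝ) :
    (Matrix.trace (preState θ 0 * pauliZString (Pi.single i 1))).re = 1 := by
  rw [preState_zero, zeroState, pauliZString_single_eq_diagonal, Matrix.trace_mul_comm,
    Matrix.trace]
  simp [Matrix.diagonal_mul, Matrix.single_apply, Matrix.diag]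

/-- By cyclicity of the trace the entangler acts on the observable, which it fixes. -/
theorem trace_preState_succ {i : Fin n} (hi : i.val = 0) (θ : GenParam n d → ℝ) (l : Fin d) :
    Matrix.trace (preState θ l.succ * pauliZString (Pi.single i 1))
      = Matrix.trace (rotationLayer θ l.castSucc * preState θ l.castSucc *
        (rotationLayer θ l.castSucc)ᴴ * pauliZString (Pi.single i 1)) := by
  rw [preState_succ θ l]
  conv_rhs => rw [← pairwiseEntangler_conj_pauliZString hi]
  rw [Matrix.mul_assoc, Matrix.mul_assoc, Matrix.trace_mul_comm]
  simp only [Matrix.mul_assoc]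

theorem integral_preState_mul_cosProd {i : Fin n} (hi : i.val = 0) (l : Fin (d + 1)) :
    ∫ θ : GenParam n d → ℝ, (Matrix.trace (preState θ l *
        pauliZString (Pi.single i 1))).re * cosProd i l θ ∂generatorLaw n d
      = (1 / 2) ^ l.val := by
  induction l using Fin.induction with
  | zero => simp [re_trace_preState_zero, cosProd_zero]
  | succ l ih =>
    simp_rw [trace_preState_succ hi, cosProd_succ]
    rw [integral_layer_mul_cosProd, ih, Fin.val_succ, Fin.val_castSucc, pow_succ]
    ring

/-- The test function that detects the Pauli string with a single `Z` on qubit `i`. -/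
noncomputable def cosTest (i : Fin n) (θ : GenParam n d → ℝ) : ℝ :=
  Real.cos (θ (Fin.last d, i, 0)) * cosProd i (Fin.last d) θ

theorem continuous_cosTest (i : Fin n) : Continuous (cosTest (d := d) i) := by
  have := continuous_cosProd i (Fin.last d)
  unfold cosTest
  fun_prop

theorem cosTest_update (i : Fin n) (θ : GenParam n d → ℝ) (t : ℝ) :
    cosTest i (Function.update θ (Fin.last d, i, 0) t)
      = Real.cos t * cosProd i (Fin.last d) θ := by
  rw [cosTest, cosProd_update θ i i (Or.inl le_rfl), Function.update_self]

theorem abs_cosTest_le_one (i : Fin n) (θ : GenParam n d → ℝ) : |cosTest i θ| ≤ 1 := by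
  rw [cosTest, abs_mul]
  exact mul_le_one₀ (Real.abs_cos_le_one _) (abs_nonneg _) (abs_cosProd_le_one _ _ _)

theorem integral_cosTest (i : Fin n) : ∫ θ, cosTest i θ ∂generatorLaw n d = 0 := by
  rw [integral_generatorLaw_of_update (g := fun _ => 0) (Fin.last d, i, 0) (continuous_cosTest i),
    integral_zero]
  intro θ
  have := integral_trig_uniformAngle' (cosProd i (Fin.last d) θ) 0
  rw [← this]
  congr 1
  ext t
  rw [cosTest_update]
  ring

theorem integral_pauliLoss_mul_cosTest {i : Fin n} (hi : i.val = 0) (α : Bits n) :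
    ∫ θ, pauliLoss α θ * cosTest i θ ∂generatorLaw n d
      = if α = Pi.single i 1 then (1 / 2) ^ (d + 1) else 0 := by
  split_ifs with h
  · subst h
    have := integral_layer_mul_cosProd i (Fin.last d)
    rw [integral_preState_mul_cosProd hi, Fin.val_last] at this
    refine Eq.trans (integral_congr_ae (ae_of_all _ fun θ => ?_)) (this.trans (pow_succ' _ _).symm)
    simp only [trace_rotationLayer, pauliLoss_eq, cosTest]
  · have hcont : Continuous fun θ : GenParam n d → ℝ => pauliLoss α θ * cosTest i θ :=
      (continuous_pauliLoss α).mul (continuous_cosTest i)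
    -- If `α i = 0`, the last `R_Y` angle of qubit `i` enters only through a cosine in the test.
    -- Otherwise `α` has another 1 at some `j`, whose last `R_Y` angle enters only the loss, with
    -- zero average.
    rcases (by omega : α i = 0 ∨ α i = 1) with hαi | hαi
    · rw [integral_generatorLaw_of_update (g := fun _ => 0) (Fin.last d, i, 0) hcont,
        integral_zero]
      intro θ
      have := integral_trig_uniformAngle' (pauliLoss α θ * cosProd i (Fin.last d) θ) 0
      rw [← this]
      congr 1
      ext t
      rw [cosTest_update, pauliLoss_update_of_eq_zero hαi]
      ring
    · obtain ⟨j, hj⟩ := Function.ne_iff.1 h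
      have hji : j ≠ i := by
        rintro rfl
        simp [hαi] at hj
      have hαj : α j = 1 := by
        rw [Pi.single_eq_of_ne hji] at hj
        omega
      rw [integral_generatorLaw_of_update (g := fun _ => 0) (Fin.last d, j, 0) hcont,
        integral_zero]
      intro θ
      obtain ⟨p, q, hpq⟩ := exists_pauliLoss_update_of_eq_one hαj θ
      have := integral_trig_uniformAngle' (p * cosTest i θ) (q * cosTest i θ)
      rw [← this]
      congr 1
      ext t
      rw [hpq, cosTest, cosProd_update θ i j (Or.inr hji), Function.update_of_ne, ← cosTest]
      · ring
      · simp [hji.symm]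

/-- The partial derivative of a Pauli loss given by the parameter shift rule. -/
noncomputable def pauliLossDeriv (α : Bits n) (i : Fin n) (θ : GenParam n d → ℝ) : ℝ :=
  (pauliLoss α (Function.update θ (Fin.last d, i, 0) (θ (Fin.last d, i, 0) + Real.pi / 2))
    - pauliLoss α (Function.update θ (Fin.last d, i, 0) (θ (Fin.last d, i, 0) - Real.pi / 2))) / 2

theorem continuous_pauliLossDeriv (α : Bits n) (i : Fin n) :
    Continuous (pauliLossDeriv (d := d) α i) := by
  unfold pauliLossDeriv
  have h : ∀ r : ℝ, Continuous fun θ : GenParam n d → ℝ =>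
      pauliLoss α (Function.update θ (Fin.last d, i, 0) (θ (Fin.last d, i, 0) + r)) := fun r =>
    (continuous_pauliLoss α).comp (continuous_id.update _ (by fun_prop))
  exact ((h _).sub (by simpa only [sub_eq_add_neg] using h (-(Real.pi / 2)))).div_const 2

theorem pauliLossDeriv_update {α : Bits n} {i : Fin n} {θ : GenParam n d → ℝ} {a p q : ℝ}
    (h : ∀ t, pauliLoss α (Function.update θ (Fin.last d, i, 0) t)
      = a + p * Real.cos t + q * Real.sin t) (t : ℝ) :
    pauliLossDeriv α i (Function.update θ (Fin.last d, i, 0) t)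
      = -p * Real.sin t + q * Real.cos t := by
  simp only [pauliLossDeriv, Function.update_idem, Function.update_self, h,
    Real.cos_add_pi_div_two, Real.sin_add_pi_div_two, Real.cos_sub_pi_div_two,
    Real.sin_sub_pi_div_two]
  ring

/-- In one angle the loss is a trigonometric polynomial of degree one, for which shifts by a quarter
period give the exact derivative. -/
theorem hasDerivAt_pauliLoss (α : Bits n) (i : Fin n) (θ : GenParam n d → ℝ) :
    HasDerivAt (fun t => pauliLoss α (Function.update θ (Fin.last d, i, 0) t))
      (pauliLossDeriv α i θ) (θ (Fin.last d, i, 0)) := by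
  obtain ⟨a, p, q, h⟩ := exists_pauliLoss_update α i θ
  have h1 := pauliLossDeriv_update h (θ (Fin.last d, i, 0))
  rw [Function.update_eq_self] at h1
  simp_rw [h, h1]
  have h2 := (((Real.hasDerivAt_cos (θ (Fin.last d, i, 0))).const_mul p).const_add a).add
    ((Real.hasDerivAt_sin (θ (Fin.last d, i, 0))).const_mul q)
  refine h2.congr_deriv ?_
  ring

/-- The test function that detects the partial derivative of a single `Z` on qubit `i`. -/
noncomputable def sinTest (i : Fin n) (θ : GenParam n d → ℝ) : ℝ :=
  -Real.sin (θ (Fin.last d, i, 0)) * cosProd i (Fin.last d) θ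

theorem continuous_sinTest (i : Fin n) : Continuous (sinTest (d := d) i) := by
  have := continuous_cosProd i (Fin.last d)
  unfold sinTest
  fun_prop

theorem sinTest_update (i : Fin n) (θ : GenParam n d → ℝ) (t : ℝ) :
    sinTest i (Function.update θ (Fin.last d, i, 0) t)
      = -Real.sin t * cosProd i (Fin.last d) θ := by
  rw [sinTest, cosProd_update θ i i (Or.inl le_rfl), Function.update_self]

theorem abs_sinTest_le_one (i : Fin n) (θ : GenParam n d → ℝ) : |sinTest i θ| ≤ 1 := by
  rw [sinTest, abs_mul, abs_neg]
  exact mul_le_one₀ (Real.abs_sin_le_one _) (abs_nonneg _) (abs_cosProd_le_one _ _ _)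

theorem integral_sinTest (i : Fin n) : ∫ θ, sinTest i θ ∂generatorLaw n d = 0 := by
  rw [integral_generatorLaw_of_update (g := fun _ => 0) (Fin.last d, i, 0) (continuous_sinTest i),
    integral_zero]
  intro θ
  have := integral_trig_uniformAngle' 0 (-cosProd i (Fin.last d) θ)
  rw [← this]
  congr 1
  ext t
  rw [sinTest_update]
  ring

/-- Integration by parts in one angle. -/
theorem integral_pauliLossDeriv_mul_sinTest (i : Fin n) (α : Bits n) :
    ∫ θ, pauliLossDeriv α i θ * sinTest i θ ∂generatorLaw n d
      = ∫ θ, pauliLoss α θ * cosTest i θ ∂generatorLaw n d := by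
  have hc : Continuous fun θ : GenParam n d → ℝ => pauliLoss α θ * cosTest i θ :=
    (continuous_pauliLoss α).mul (continuous_cosTest i)
  have hs : Continuous fun θ : GenParam n d → ℝ => pauliLossDeriv α i θ * sinTest i θ :=
    (continuous_pauliLossDeriv α i).mul (continuous_sinTest i)
  -- Both integrands are averaged over the same angle; for `a + p cos + q sin` both averages equal
  -- `p w / 2`.
  rw [integral_generatorLaw_of_update (Fin.last d, i, 0) hc fun _ => rfl]
  refine integral_generatorLaw_of_update (Fin.last d, i, 0) hs fun θ => ?_
  obtain ⟨a, p, q, h⟩ := exists_pauliLoss_update α i θ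
  set w := cosProd i (Fin.last d) θ with hw
  have h1 := integral_trig_uniformAngle 0 q (-p) 0 (-w)
  have h2 := integral_trig_uniformAngle a p q w 0
  calc _ = (q * 0 + -p * -w) / 2 := by
        rw [← h1]
        congr 1
        ext t
        rw [pauliLossDeriv_update h, sinTest_update]
        ring
    _ = (p * w + q * 0) / 2 := by ring
    _ = _ := by
        rw [← h2]
        congr 1
        ext t
        rw [h, cosTest_update]
        ring

end TestFunctions

/-! ### Variance bounds for the loss and its gradient. -/

section GeneratorLoss

variable {n : ℕ} (d : ℕ) (D : Discriminator n)

theorem hasDerivAt_generatorLoss (i : Fin n) (θ : GenParam n d → ℝ) (φ : D.Param) :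
    HasDerivAt (fun t => generatorLoss d D (Function.update θ (Fin.last d, i, 0) t) φ)
      (∑ α, D.coeff α φ * pauliLossDeriv α i θ) (θ (Fin.last d, i, 0)) := by
  unfold generatorLoss
  exact HasDerivAt.fun_sum fun α _ => (hasDerivAt_pauliLoss α i θ).const_mul _

theorem le_evariance_generatorLoss {i : Fin n} (hi : i.val = 0) :
    ENNReal.ofReal (((1 / 2) ^ (d + 1)) ^ 2) *
        ∫⁻ φ, ‖D.coeff (Pi.single i 1) φ‖ₑ ^ 2 ∂D.paramLaw
      ≤ eVar[fun ω => generatorLoss d D ω.1 ω.2; jointLaw d D] :=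
  le_evariance_of_test (generatorLaw n d) D.paramLaw (Pi.single i 1)
    (fun α => (D.continuous_coeff α).measurable) (fun α => (continuous_pauliLoss α).measurable)
    (fun α => integrable_generatorLaw ((continuous_pauliLoss α).mul (continuous_cosTest i)))
    (integrable_generatorLaw (continuous_cosTest i)) (abs_cosTest_le_one i) (integral_cosTest i)
    (integral_pauliLoss_mul_cosTest hi)

theorem le_evariance_deriv_generatorLoss {i : Fin n} (hi : i.val = 0) :
    ENNReal.ofReal (((1 / 2) ^ (d + 1)) ^ 2) *
        ∫⁻ φ, ‖D.coeff (Pi.single i 1) φ‖ₑ ^ 2 ∂D.paramLaw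
      ≤ eVar[fun ω => deriv (fun t => generatorLoss d D
          (Function.update ω.1 (Fin.last d, i, 0) t) ω.2) (ω.1 (Fin.last d, i, 0));
          jointLaw d D] := by
  simp_rw [(hasDerivAt_generatorLoss d D i _ _).deriv]
  exact le_evariance_of_test (generatorLaw n d) D.paramLaw (Pi.single i 1)
    (fun α => (D.continuous_coeff α).measurable)
    (fun α => (continuous_pauliLossDeriv α i).measurable)
    (fun α => integrable_generatorLaw
      ((continuous_pauliLossDeriv α i).mul (continuous_sinTest i)))
    (integrable_generatorLaw (continuous_sinTest i)) (abs_sinTest_le_one i) (integral_sinTest i)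
    fun α => by rw [integral_pauliLossDeriv_mul_sinTest, integral_pauliLoss_mul_cosTest hi]

theorem memLp_generatorLoss (hb : ∀ l, MemLp (fun t : ℝ => t) 2 (D.biasLaw l)) :
    MemLp (fun ω => generatorLoss d D ω.1 ω.2) 2 (jointLaw d D) := by
  unfold generatorLoss jointLaw
  refine memLp_finsetSum _ fun α _ => ?_
  obtain ⟨C, hC⟩ := exists_bound_generatorLaw (continuous_pauliLoss (n := n) (d := d) α)
  have hL : MemLp (fun θ : GenParam n d → ℝ => pauliLoss α θ) 2 (generatorLaw n d) :=
    MemLp.of_bound (continuous_pauliLoss α).aestronglyMeasurable C hC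
  simpa only [mul_comm] using Discriminator.memLp_mul_prod hL (D.memLp_coeff hb α)

end GeneratorLoss

/-! ### Polynomial against exponential decay. -/

section Asymptotics

/-- A logarithmic depth gives a polynomially small factor. -/
theorem exists_poly_le_of_log_depth {d : ℕ → ℕ}
    (hd : (fun n : ℕ => (d n : ℝ)) =O[atTop] fun n : ℕ => Real.log n) :
    ∃ p : ℕ, ∀ᶠ n : ℕ in atTop, 1 / 4 / (n : ℝ) ^ p ≤ ((1 / 2) ^ (d n + 1)) ^ 2 := by
  obtain ⟨K, hK⟩ := hd.bound
  -- From `d ≤ K log n` follows `4 ^ d ≤ n ^ (K log 4)`.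
  obtain ⟨p, hp⟩ := exists_nat_ge (K * Real.log 4)
  refine ⟨p, ?_⟩
  filter_upwards [hK, eventually_ge_atTop 1] with n hn hn1
  have hn0 : (0 : ℝ) < n := by exact_mod_cast hn1
  have hlog : 0 ≤ Real.log n := Real.log_natCast_nonneg n
  rw [Real.norm_of_nonneg (Nat.cast_nonneg _), Real.norm_of_nonneg hlog] at hn
  have h4 : (4 : ℝ) ^ d n ≤ (n : ℝ) ^ p := by
    rw [← Real.log_le_log_iff (by positivity) (by positivity), Real.log_pow, Real.log_pow]
    have h4pos : 0 ≤ Real.log 4 := Real.log_nonneg (by norm_num)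
    calc (d n : ℝ) * Real.log 4 ≤ K * Real.log n * Real.log 4 := by gcongr
      _ = K * Real.log 4 * Real.log n := by ring
      _ ≤ p * Real.log n := by gcongr
  rw [← pow_mul, mul_comm, pow_mul, show ((1 : ℝ) / 2) ^ 2 = 1 / 4 by norm_num, pow_succ,
    one_div_pow]
  rw [div_eq_mul_one_div, mul_comm]
  gcongr

theorem not_eventually_poly_le_exp {C : ℝ} (hC : 0 < C) (p : ℕ) {b : ℝ} (hb : 1 < b) (C' : ℝ) :
    ¬ ∀ᶠ n : ℕ in atTop, C / (n : ℝ) ^ p ≤ C' / b ^ n := by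
  intro h
  have hlim : Tendsto (fun n : ℕ => C' * ((n : ℝ) ^ p / b ^ n)) atTop (nhds (C' * 0)) :=
    (tendsto_pow_const_div_const_pow_of_one_lt p hb).const_mul C'
  rw [mul_zero] at hlim
  obtain ⟨n, h1, h2, h3⟩ := (h.and ((hlim.eventually_lt_const hC).and
    (eventually_ge_atTop 1))).exists
  have hn0 : (0 : ℝ) < (n : ℝ) ^ p := pow_pos (by exact_mod_cast h3) p
  rw [div_le_iff₀ hn0] at h1
  have : C' / b ^ n * (n : ℝ) ^ p = C' * ((n : ℝ) ^ p / b ^ n) := by ring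
  linarith

end Asymptotics

end QGAN

theorem corollary2
    (d : ℕ → ℕ)
    (hd : (fun n : ℕ => (d n : ℝ)) =O[atTop] fun n : ℕ => Real.log n)
    (D : ∀ n : ℕ, QGAN.Discriminator n)
    (hhidden : ∀ n (l : Fin (D n).L),
      4 ≤ ((D n).hiddenWidth l : ℝ) * (D n).weightStd l.castSucc ^ 2)
    (s : ℝ) (hs : 0 < s)
    (hout : ∀ n, s ≤ (D n).weightStd (Fin.last (D n).L) ^ 2) :
    (∃ C : ℝ, 0 < C ∧ ∃ p : ℕ, ∀ᶠ n : ℕ in atTop,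
      ENNReal.ofReal (C / (n : ℝ) ^ p) ≤
        eVar[fun ω => QGAN.generatorLoss (d n) (D n) ω.1 ω.2; QGAN.jointLaw (d n) (D n)]) ∧
    (∀ n, (∀ l, MemLp (fun t : ℝ => t) 2 ((D n).biasLaw l)) →
      MemLp (fun ω => QGAN.generatorLoss (d n) (D n) ω.1 ω.2) 2 (QGAN.jointLaw (d n) (D n))) ∧
    ¬ QGAN.HasBarrenPlateau (fun n => QGAN.jointLaw (d n) (D n))
        (fun n => QGAN.generatorLoss (d n) (D n)) := by
  obtain ⟨p, hp⟩ := QGAN.exists_poly_le_of_log_depth hd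
  -- The constant `s / 64` is 1/4 from the circuit times `s / 16` from the discriminator.
  have hbound : ∀ (n : ℕ) (i : Fin n), 1 / 4 / (n : ℝ) ^ p ≤ ((1 / 2) ^ (d n + 1)) ^ 2 →
      ENNReal.ofReal (s / 64 / (n : ℝ) ^ p) ≤ ENNReal.ofReal (((1 / 2) ^ (d n + 1)) ^ 2) *
        ∫⁻ φ, ‖(D n).coeff (Pi.single i 1) φ‖ₑ ^ 2 ∂(D n).paramLaw := by
    intro n i hn
    calc ENNReal.ofReal (s / 64 / (n : ℝ) ^ p)
        = ENNReal.ofReal (1 / 4 / (n : ℝ) ^ p) * ENNReal.ofReal (s / 16) := by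
          rw [← ENNReal.ofReal_mul (by positivity)]
          congr 1
          ring
      _ ≤ _ := by
          gcongr
          exact (D n).le_lintegral_coeff_sq (hhidden n) hs.le (hout n) i
  refine ⟨⟨s / 64, by positivity, p, ?_⟩, fun n hb => QGAN.memLp_generatorLoss _ _ hb, ?_⟩
  · filter_upwards [hp, eventually_ge_atTop 1] with n hn hn1
    exact (hbound n ⟨0, hn1⟩ hn).trans (QGAN.le_evariance_generatorLoss (d n) (D n) rfl)
  · rintro ⟨b, hb, C, hC⟩
    -- The constant `C` may be negative; `max C 0` makes the right side nonnegative, as needed to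
    -- remove `ENNReal.ofReal`.
    refine QGAN.not_eventually_poly_le_exp (C := s / 64) (by positivity) p hb (max C 0) ?_
    filter_upwards [hp, hC, eventually_ge_atTop 1] with n hn hCn hn1
    -- One parameter suffices: the `R_Y` angle of qubit 0 in the last layer.
    have h1 := ((hbound n ⟨0, hn1⟩ hn).trans
      (QGAN.le_evariance_deriv_generatorLoss (d n) (D n) rfl)).trans
        (hCn (Fin.last (d n), ⟨0, hn1⟩, 0))
    have hbn : 0 < b ^ n := pow_pos (by linarith) n
    have h2 : C / b ^ n ≤ max C 0 / b ^ n := by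
      gcongr
      exact le_max_left _ _
    exact (ENNReal.ofReal_le_ofReal_iff (div_nonneg (le_max_right _ _) hbn.le)).1
      (h1.trans (ENNReal.ofReal_le_ofReal h2))
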